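/- Let $T>0$, $a>0$, $\rho\in(0,T)$ and $0<k<K<\infty$ be known, and let $\kappa_0\in(k,K)$. For $\varepsilon>0$ let $$dX_t=a|t-\rho|^{\kappa_0}\,dt+\varepsilon\,dW_t,\qquad X_0=0,\quad 0\le t\le T,$$ where $W$ is a standard Brownian motion (the probability space may depend on $\varepsilon$), and let $$V(\kappa,X^T)=\exp\left\{\int_0^T\frac{a|t-\rho|^{\kappa}}{\varepsilon^2}\,dX_t-\int_0^T\frac{a^2|t-\rho|^{2\kappa}}{2\varepsilon^2}\,dt\right\},\qquad \kappa\in[k,K],$$ be the likelihood ratio function, taken in a version that is almost surely continuous in $\kappa\in[k,K]$. Let $\hat\kappa_\varepsilon$ be a maximum likelihood estimator of $\kappa$, i.e. a random variable such that, almost surely on the event that $\sup_{\kappa\in(k,K)}V(\kappa,X^T)$ is attained in $(k,K)$, $$\hat\kappa_\varepsilon\in[k,K],\qquad V(\hat\kappa_\varepsilon,X^T)=\sup_{\kappa\in(k,K)}V(\kappa,X^T);$$ off this event its value is arbitrary. Then the Fisher information $$I(\kappa_0)=a^2\int_0^T|t-\rho|^{2\kappa_0}\,(\ln|t-\rho|)^2\,dt$$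 is finite and strictly positive, and, as $\varepsilon\to0$, $$\frac{\hat\kappa_\varepsilon-\kappa_0}{\varepsilon}\Longrightarrow\mathcal N\bigl(0,I(\kappa_0)^{-1}\bigr)\quad\text{in distribution}.$$ -/

import Mathlib

open MeasureTheory ProbabilityTheory Set Filter Topology
open scoped NNReal ENNReal

noncomputable section

namespace CuspExponent

/-- A (left-continuous) step function on `[0, T]`: a finite linear combination
`∑ i, coeff i • 1_{(lo i, hi i]}` with `0 ≤ lo i ≤ hi i ≤ T`. -/
structure StepFun (T : ℝ≥0) where
  n : ℕ
  coeff : Fin n → ℝ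
  lo : Fin n → ℝ≥0
  hi : Fin n → ℝ≥0
  lo_le_hi : ∀ i, lo i ≤ hi i
  hi_le : ∀ i, hi i ≤ T

namespace StepFun

/-- The step function as a function of time. -/
def toFun {T : ℝ≥0} (φ : StepFun T) (t : ℝ) : ℝ :=
  ∑ i, (Ioc (φ.lo i : ℝ) (φ.hi i : ℝ)).indicator (fun _ => φ.coeff i) t

/-- The elementary integral `∫ φ dX = ∑ i, coeff i * (X_{hi i} - X_{lo i})`. -/
def integral {T : ℝ≥0} (φ : StepFun T) {Ω : Type*} (X : ℝ≥0 → Ω → ℝ) (ω : Ω) : ℝ :=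
  ∑ i, φ.coeff i * (X (φ.hi i) ω - X (φ.lo i) ω)

end StepFun

/-- `I` is (a version of) the stochastic integral `∫_0^T f(t) dX_t` of the deterministic
function `f`, for `X` an Ito process with deterministic square integrable drift and constant
diffusion coefficient: `I` is the limit in probability of the elementary integrals of step
functions which converge to `f` in `L²(0, T)`. -/
def IsStochIntegral {Ω : Type*} [MeasurableSpace Ω] (P : Measure Ω) (T : ℝ≥0)
    (X : ℝ≥0 → Ω → ℝ) (f : ℝ → ℝ) (I : Ω → ℝ) : Prop :=
  ∃ φ : ℕ → StepFun T,
    Tendsto (fun n => eLpNorm (fun t => (φ n).toFun t - f t) 2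
      (volume.restrict (Icc (0 : ℝ) (T : ℝ)))) atTop (𝓝 0) ∧
    TendstoInMeasure P (fun n => (φ n).integral X) atTop I

/-- `X` solves `dX_t = a |t - ρ|^κ₀ dt + ε dW_t`, `X_0 = 0`, on `[0, T]`. -/
def IsObservation {Ω : Type*} [MeasurableSpace Ω] (P : Measure Ω) (T : ℝ≥0)
    (a ρ κ₀ ε : ℝ) (W X : ℝ≥0 → Ω → ℝ) : Prop :=
  ∀ᵐ ω ∂P, ∀ t : ℝ≥0, t ≤ T →
    X t ω = (∫ s in (0 : ℝ)..(t : ℝ), a * |s - ρ| ^ κ₀) + ε * W t ω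

/-- `V` is the likelihood ratio function
`V(κ, X^T) = exp (∫_0^T (a |t-ρ|^κ / ε²) dX_t - ∫_0^T (a² |t-ρ|^(2κ) / (2 ε²)) dt)`.
The stochastic integral determines `V κ` up to a null set for each `κ`; as usual, `V` is a
version whose paths `κ ↦ V κ ω` are almost surely continuous (up to the end points `k` and `K`
of the parameter interval). -/
structure IsLikelihoodRatio {Ω : Type*} [MeasurableSpace Ω] (P : Measure Ω) (T : ℝ≥0)
    (a ρ k K ε : ℝ) (X : ℝ≥0 → Ω → ℝ) (V : ℝ → Ω → ℝ) : Prop where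
  eq_exp : ∀ κ ∈ Icc k K, ∃ I : Ω → ℝ,
    IsStochIntegral P T X (fun t => a * |t - ρ| ^ κ / ε ^ 2) I ∧
    ∀ᵐ ω ∂P, V κ ω = Real.exp
      (I ω - ∫ t in (0 : ℝ)..(T : ℝ), a ^ 2 * |t - ρ| ^ (2 * κ) / (2 * ε ^ 2))
  continuousOn : ∀ᵐ ω ∂P, ContinuousOn (fun κ => V κ ω) (Icc k K)

/-- `κhat` is a maximum likelihood estimator: `V(κhat) = sup_{κ ∈ (k, K)} V(κ)`, a.s. on the event
that the supremum over the open interval `(k, K)` is attained. Off this event (on which the equation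
has no solution in `(k, K)`) the value of `κhat` is arbitrary. A solution may also lie at an end
point, so that a maximizer over `[k, K]` is an example too. -/
def IsMLE {Ω : Type*} [MeasurableSpace Ω] (P : Measure Ω) (k K : ℝ)
    (V : ℝ → Ω → ℝ) (κhat : Ω → ℝ) : Prop :=
  ∀ᵐ ω ∂P, (∃ κ ∈ Ioo k K, IsMaxOn (fun κ' => V κ' ω) (Ioo k K) κ) →
    κhat ω ∈ Icc k K ∧ IsLUB ((fun κ' => V κ' ω) '' Ioo k K) (V (κhat ω) ω)

/-- The Fisher information `a² ∫_0^T |t-ρ|^(2κ) (ln |t-ρ|)² dt`. -/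
def fisherInfo (T : ℝ≥0) (a ρ κ : ℝ) : ℝ :=
  a ^ 2 * ∫ t in (0 : ℝ)..(T : ℝ), |t - ρ| ^ (2 * κ) * (Real.log |t - ρ|) ^ 2

end CuspExponent

end

/-!
Write `S_κ(t) = a |t - ρ| ^ κ` for the signal. Under the true exponent `κ₀`, and up to a term which
does not depend on `κ`, `ε²` times the log-likelihood at `κ` is the contrast
`m(κ) = -‖S_κ - S_κ₀‖² / 2 + ε (Z(κ) - Z(κ₀))`, where `‖·‖` is the norm of `L²(0, T)` and
`Z(κ) = ∫ S_κ dW`.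

All exponents are positive, so `S_κ` is absolutely continuous even though it has a cusp, and
integration by parts gives `Z(κ)` path by path: `Z(κ) = S_κ(T) W_T - ∫ W_t S_κ'(t) dt`
(`pathIntegral`). Elementary integrals of Riemann step functions converge to it along every
continuous path, and the Ito isometry for step functions shows that every stochastic integral in the
sense of `IsStochIntegral` agrees with it almost surely (`IsStochIntegral.ae_eq`), and that it is
Gaussian (`hasLaw_pathIntegral`). As both sides are continuous in `κ`, the likelihood ratio is
almost surely given by `m` for all `κ` at once (`ae_likelihood_eq`).

The pathwise formula also shows that `Z` is differentiable in `κ`, with derivative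
`Δ = ∫ ∂S_κ/∂κ dW` at `κ₀` and a remainder of at most `Q (κ - κ₀)²` (`abs_noise_taylor_le`). Here
`Q` is a weighted `L¹` norm of the path, whose expectation is bounded independently of `ε` and of
the probability space (`measure_le_pathNorm_le`). The squared distance of the signals is at least
`c (κ - κ₀)²`, and it is `I (κ - κ₀)²` up to `C |κ - κ₀|³`, with `I` the Fisher information.

On the event that `Q` is at most a constant, for small `ε`, these estimates force all points with
`m(κ) ≥ m(κ₀)` to lie within `O(ε)` of `κ₀`. So the maximum is attained in the interior, and
comparing the value of `m` at a maximizer `κ₀ + ε u` with its value at `κ₀ + ε Δ / I` gives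
`(u - Δ / I)² = O(ε)` (`sq_sub_le_of_max`). As `Δ / I` has the law `N(0, 1 / I)` for every `ε`, a
version of Slutsky's theorem for varying probability spaces concludes.
-/

namespace CuspExponent

/-! ### Riemann sums and the pathwise Wiener integral -/

/-- A Riemann sum of `∫ v h`, in which `v` is replaced on each cell by its value at the right end,
is accurate up to the oscillation of `v` on the cells. -/
theorem sum_mul_integral_sub_le {T δ : ℝ} (n : ℕ) (τ : ℕ → ℝ) (hτ : Monotone τ) (h0 : τ 0 = 0)
    (hn : τ n = T) {v h : ℝ → ℝ} (hv : ContinuousOn v (Icc 0 T))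
    (hh : IntervalIntegrable h volume 0 T)
    (hδ : ∀ i < n, ∀ t ∈ Icc (τ i) (τ (i + 1)), |v (τ (i + 1)) - v t| ≤ δ) :
    |∑ i ∈ Finset.range n, v (τ (i + 1)) * (∫ t in (τ i)..(τ (i + 1)), h t)
      - ∫ t in (0 : ℝ)..T, v t * h t| ≤ δ * ∫ t in (0 : ℝ)..T, |h t| := by
  have hT : 0 ≤ T := by rw [← h0, ← hn]; exact hτ (Nat.zero_le n)
  have hsub : ∀ i < n, uIcc (τ i) (τ (i + 1)) ⊆ uIcc 0 T := by
    intro i hi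
    rw [uIcc_of_le (hτ (Nat.le_succ i)), uIcc_of_le hT]
    exact Icc_subset_Icc (h0 ▸ hτ (Nat.zero_le i)) (hn ▸ hτ hi)
  have hvh : IntervalIntegrable (fun t => v t * h t) volume 0 T :=
    hh.continuousOn_mul (by rwa [uIcc_of_le hT])
  have e1 : ∫ t in (0 : ℝ)..T, v t * h t
      = ∑ i ∈ Finset.range n, ∫ t in (τ i)..(τ (i + 1)), v t * h t := by
    rw [intervalIntegral.sum_integral_adjacent_intervals (fun i hi => hvh.mono_set (hsub i hi)),
      h0, hn]
  have e2 : ∫ t in (0 : ℝ)..T, |h t|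
      = ∑ i ∈ Finset.range n, ∫ t in (τ i)..(τ (i + 1)), |h t| := by
    rw [intervalIntegral.sum_integral_adjacent_intervals
      (fun i hi => hh.abs.mono_set (hsub i hi)), h0, hn]
  rw [e1, e2, ← Finset.sum_sub_distrib, Finset.mul_sum]
  refine (Finset.abs_sum_le_sum_abs _ _).trans (Finset.sum_le_sum fun i hi => ?_)
  have hi := Finset.mem_range.1 hi
  have hle := hτ (Nat.le_succ i)
  have hhi := hh.mono_set (hsub i hi)
  rw [← intervalIntegral.integral_const_mul, ← intervalIntegral.integral_sub
    (hhi.const_mul _) (hvh.mono_set (hsub i hi)), ← intervalIntegral.integral_const_mul]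
  refine (intervalIntegral.abs_integral_le_integral_abs hle).trans
    (intervalIntegral.integral_mono_on hle ?_ (hhi.abs.const_mul _) fun t ht => ?_)
  · exact ((hhi.const_mul _).sub (hvh.mono_set (hsub i hi))).abs
  · rw [← sub_mul, abs_mul]
    exact mul_le_mul_of_nonneg_right (hδ i hi t ht) (abs_nonneg _)

/-- The point `i T / n` of the uniform grid with `n` cells on `[0, T]`. -/
noncomputable def grid (T : ℝ≥0) (n i : ℕ) : ℝ≥0 := T * i / n

theorem grid_mono (T : ℝ≥0) (n : ℕ) : Monotone (grid T n) := fun i j hij => by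
  unfold grid
  gcongr

@[simp] theorem grid_zero (T : ℝ≥0) (n : ℕ) : grid T n 0 = 0 := by simp [grid]

theorem grid_self (T : ℝ≥0) {n : ℕ} (hn : n ≠ 0) : grid T n n = T := by
  have : (n : ℝ≥0) ≠ 0 := by exact_mod_cast hn
  unfold grid
  field_simp

theorem grid_le (T : ℝ≥0) {n i : ℕ} (hi : i ≤ n) : grid T n i ≤ T := by
  rcases Nat.eq_zero_or_pos n with rfl | hn
  · simp [grid]
  · exact (grid_mono T n hi).trans (grid_self T hn.ne').le

theorem grid_succ_sub (T : ℝ≥0) (n i : ℕ) :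
    (grid T n (i + 1) : ℝ) - grid T n i = T / n := by
  simp only [grid, NNReal.coe_div, NNReal.coe_mul, NNReal.coe_natCast]
  push_cast
  ring

/-- A continuous function oscillates little on the cells of a fine grid. -/
theorem eventually_grid_osc_le {T : ℝ≥0} {v : ℝ → ℝ} (hv : ContinuousOn v (Icc 0 (T : ℝ)))
    {δ : ℝ} (hδ : 0 < δ) : ∀ᶠ n : ℕ in atTop, ∀ i < n,
      ∀ s ∈ Icc (grid T n i : ℝ) (grid T n (i + 1)),
      ∀ t ∈ Icc (grid T n i : ℝ) (grid T n (i + 1)), |v s - v t| ≤ δ := by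
  have huc := isCompact_Icc.uniformContinuousOn_of_continuous hv
  rw [Metric.uniformContinuousOn_iff] at huc
  obtain ⟨η, hη, H⟩ := huc δ hδ
  have : Tendsto (fun n : ℕ => (T : ℝ) / n) atTop (𝓝 0) := tendsto_const_div_atTop_nhds_zero_nat _
  filter_upwards [this.eventually_lt_const hη] with n hn i hi s hs t ht
  have h1 : (0 : ℝ) ≤ grid T n i := NNReal.coe_nonneg _
  have h2 : (grid T n (i + 1) : ℝ) ≤ T := by exact_mod_cast grid_le T hi
  refine (H s ⟨h1.trans hs.1, hs.2.trans h2⟩ t ⟨h1.trans ht.1, ht.2.trans h2⟩ ?_).le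
  have := grid_succ_sub T n i
  rw [Real.dist_eq, abs_sub_lt_iff]
  constructor <;> linarith [hs.1, hs.2, ht.1, ht.2]

theorem tendsto_sum_mul_integral {T : ℝ≥0} {v h : ℝ → ℝ} (hv : ContinuousOn v (Icc 0 (T : ℝ)))
    (hh : IntervalIntegrable h volume 0 T) :
    Tendsto (fun n : ℕ => ∑ i ∈ Finset.range n, v (grid T n (i + 1))
        * ∫ t in (grid T n i : ℝ)..(grid T n (i + 1)), h t) atTop
      (𝓝 (∫ t in (0 : ℝ)..T, v t * h t)) := by
  rw [Metric.tendsto_nhds]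
  intro δ hδ
  set J := ∫ t in (0 : ℝ)..T, |h t|
  have hJ : 0 ≤ J := intervalIntegral.integral_nonneg T.2 fun t _ => abs_nonneg _
  have hδ' : 0 < δ / (J + 1) := by positivity
  filter_upwards [eventually_grid_osc_le hv hδ', eventually_ne_atTop 0] with n hn hn0
  rw [Real.dist_eq]
  have hm : Monotone fun i => (grid T n i : ℝ) := fun i j hij => by
    exact_mod_cast grid_mono T n hij
  refine (sum_mul_integral_sub_le n (fun i => (grid T n i : ℝ)) hm (by simp)
    (by simp [grid_self T hn0]) hv hh fun i hi t ht => hn i hi _ ?_ t ht).trans_lt ?_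
  · exact right_mem_Icc.2 (hm (Nat.le_succ i))
  · change δ / (J + 1) * J < δ
    rw [div_mul_eq_mul_div, div_lt_iff₀ (by positivity)]
    nlinarith

/-- `f` is continuous and it is on `[0, T]` a primitive of the integrable function `g`. -/
structure IsPrimitive (T : ℝ≥0) (f g : ℝ → ℝ) : Prop where
  continuous : Continuous f
  integrable : IntervalIntegrable g volume 0 T
  integral_eq : ∀ s ∈ Icc 0 (T : ℝ), ∀ t ∈ Icc 0 (T : ℝ), ∫ x in s..t, g x = f t - f s

/-- The Wiener integral `∫_0^T f dw` along a single path `w` with `w 0 = 0`, defined through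
integration by parts for a function `f` with derivative `g`. -/
noncomputable def pathIntegral (T : ℝ≥0) (f g : ℝ → ℝ) (w : ℝ≥0 → ℝ) : ℝ :=
  f T * w T - ∫ t in (0 : ℝ)..T, w t.toNNReal * g t

/-- The step function equal to `f (i T / n)` on the cell `(i T / n, (i + 1) T / n]`. -/
noncomputable def riemannStep (T : ℝ≥0) (f : ℝ → ℝ) (n : ℕ) : StepFun T where
  n := n
  coeff i := f (grid T n i)
  lo i := grid T n i
  hi i := grid T n (i + 1)
  lo_le_hi i := grid_mono T n (Nat.le_succ i)
  hi_le i := grid_le T i.2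

theorem sum_indicator_Ioc {τ : ℕ → ℝ} (hτ : Monotone τ) (n : ℕ) (c t : ℝ) :
    ∑ i ∈ Finset.range n, (Ioc (τ i) (τ (i + 1))).indicator (fun _ => c) t
      = (Ioc (τ 0) (τ n)).indicator (fun _ => c) t := by
  induction n with
  | zero => simp
  | succ n ih =>
    rw [Finset.sum_range_succ, ih, ← Ioc_union_Ioc_eq_Ioc (hτ (Nat.zero_le n)) (hτ (Nat.le_succ n)),
      indicator_union_of_disjoint]
    rw [Set.disjoint_left]
    intro x hx hx'
    exact absurd hx.2 (not_le.2 hx'.1)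

/-- A step function with values of `f` is as close to `f` as `f` oscillates on the cells. The left
end point `0` is excluded, as no cell contains it. -/
theorem riemannStep_toFun_sub_le {T : ℝ≥0} {f : ℝ → ℝ} {δ : ℝ} {n : ℕ} (hn : n ≠ 0)
    (hδ : ∀ i < n, ∀ s ∈ Icc (grid T n i : ℝ) (grid T n (i + 1)),
      ∀ t ∈ Icc (grid T n i : ℝ) (grid T n (i + 1)), |f s - f t| ≤ δ)
    {t : ℝ} (ht : t ∈ Ioc 0 (T : ℝ)) : |(riemannStep T f n).toFun t - f t| ≤ δ := by
  have hm : Monotone fun i => (grid T n i : ℝ) := fun i j hij => by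
    exact_mod_cast grid_mono T n hij
  -- the cells partition `(0, T]`
  have key : ∀ c : ℝ, c = ∑ i ∈ Finset.range n,
      (Ioc (grid T n i : ℝ) (grid T n (i + 1))).indicator (fun _ => c) t := by
    intro c
    rw [sum_indicator_Ioc hm n c t]
    simp only [grid_zero, grid_self T hn]
    rw [indicator_of_mem (by simpa using ht)]
  have e : (riemannStep T f n).toFun t = ∑ i ∈ Finset.range n,
      (Ioc (grid T n i : ℝ) (grid T n (i + 1))).indicator (fun _ => f (grid T n i)) t := by
    rw [Finset.sum_range]
    rfl
  rw [e]
  rw [key (f t)]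
  rw [key δ, ← Finset.sum_sub_distrib]
  refine (Finset.abs_sum_le_sum_abs _ _).trans (Finset.sum_le_sum fun i hi => ?_)
  by_cases h : t ∈ Ioc (grid T n i : ℝ) (grid T n (i + 1))
  · simp only [indicator_of_mem h]
    exact hδ i (Finset.mem_range.1 hi) _ (left_mem_Icc.2 (hm (Nat.le_succ i))) t ⟨h.1.le, h.2⟩
  · simp [indicator_of_notMem h]

theorem tendsto_eLpNorm_riemannStep {T : ℝ≥0} {f : ℝ → ℝ} (hf : ContinuousOn f (Icc 0 (T : ℝ))) :
    Tendsto (fun n => eLpNorm (fun t => (riemannStep T f n).toFun t - f t) 2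
      (volume.restrict (Icc (0 : ℝ) (T : ℝ)))) atTop (𝓝 0) := by
  rw [ENNReal.tendsto_nhds_zero]
  intro e he
  set C : ℝ≥0∞ := volume.restrict (Icc (0 : ℝ) (T : ℝ)) univ ^ (2 : ℝ≥0∞).toReal⁻¹
  have hC : C ≠ ∞ := by
    refine ENNReal.rpow_ne_top_of_nonneg (by positivity) ?_
    simp
  obtain ⟨δ, hδ, hδe⟩ : ∃ δ : ℝ, 0 < δ ∧ C * ENNReal.ofReal δ ≤ e := by
    have : Tendsto (fun δ : ℝ => C * ENNReal.ofReal δ) (𝓝[>] 0) (𝓝 (C * ENNReal.ofReal 0)) :=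
      (ENNReal.Tendsto.const_mul (ENNReal.tendsto_ofReal tendsto_id) (Or.inr hC)).mono_left
        nhdsWithin_le_nhds
    rw [ENNReal.ofReal_zero, mul_zero] at this
    have h1 := (ENNReal.tendsto_nhds_zero.1 this) e he
    obtain ⟨δ, h2, h3⟩ := (h1.and self_mem_nhdsWithin).exists
    exact ⟨δ, h3, h2⟩
  filter_upwards [eventually_grid_osc_le hf hδ, eventually_ne_atTop 0] with n hn hn0
  refine (eLpNorm_le_of_ae_bound (C := δ) ?_).trans hδe
  rw [← restrict_Ioc_eq_restrict_Icc]
  filter_upwards [ae_restrict_mem measurableSet_Ioc] with t ht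
  exact riemannStep_toFun_sub_le hn0 hn ht

/-- Summation by parts: the Riemann sums of `∫ f dw` converge along every continuous path. -/
theorem tendsto_riemannStep_integral {T : ℝ≥0} {f g : ℝ → ℝ} (hfg : IsPrimitive T f g)
    {Ω : Type*} {X : ℝ≥0 → Ω → ℝ} {ω : Ω} (hw : Continuous fun t => X t ω) (hw0 : X 0 ω = 0) :
    Tendsto (fun n => (riemannStep T f n).integral X ω) atTop
      (𝓝 (pathIntegral T f g fun t => X t ω)) := by
  have hv : ContinuousOn (fun t : ℝ => X t.toNNReal ω) (Icc 0 (T : ℝ)) :=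
    (hw.comp continuous_real_toNNReal).continuousOn
  refine ((tendsto_sum_mul_integral hv hfg.integrable).const_sub (f T * X T ω)).congr' ?_
  filter_upwards [eventually_ne_atTop 0] with n hn
  have e : (riemannStep T f n).integral X ω = ∑ i ∈ Finset.range n,
      f (grid T n i) * (X (grid T n (i + 1)) ω - X (grid T n i) ω) := by
    rw [Finset.sum_range]
    rfl
  have e2 : f T * X T ω = ∑ i ∈ Finset.range n,
      (f (grid T n (i + 1)) * X (grid T n (i + 1)) ω - f (grid T n i) * X (grid T n i) ω) := by
    -- the boundary term at `0` vanishes because the path starts there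
    rw [Finset.sum_range_sub (fun i => f (grid T n i) * X (grid T n i) ω) n]
    simp [grid_self T hn, hw0]
  rw [e, e2, ← Finset.sum_sub_distrib]
  refine Finset.sum_congr rfl fun i hi => ?_
  have hi := Finset.mem_range.1 hi
  rw [hfg.integral_eq _ ⟨NNReal.coe_nonneg _, by exact_mod_cast grid_le T hi.le⟩ _
    ⟨NNReal.coe_nonneg _, by exact_mod_cast grid_le T hi⟩, Real.toNNReal_coe]
  ring

/-! ### Products of functions converging in `L²` -/

section L2

variable {α : Type*} [MeasurableSpace α] {μ : Measure α}

theorem inner_toLp_toLp {f g : α → ℝ} (hf : MemLp f 2 μ) (hg : MemLp g 2 μ) :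
    inner ℝ (hf.toLp f) (hg.toLp g) = ∫ x, f x * g x ∂μ := by
  rw [L2.inner_def]
  refine integral_congr_ae ?_
  filter_upwards [hf.coeFn_toLp, hg.coeFn_toLp] with x h1 h2
  rw [h1, h2]
  simp [mul_comm]

theorem tendsto_integral_mul_of_tendsto_eLpNorm {φ ψ : ℕ → α → ℝ} {f g : α → ℝ}
    (hφ : ∀ n, MemLp (φ n) 2 μ) (hf : MemLp f 2 μ) (hψ : ∀ n, MemLp (ψ n) 2 μ) (hg : MemLp g 2 μ)
    (h1 : Tendsto (fun n => eLpNorm (fun x => φ n x - f x) 2 μ) atTop (𝓝 0))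
    (h2 : Tendsto (fun n => eLpNorm (fun x => ψ n x - g x) 2 μ) atTop (𝓝 0)) :
    Tendsto (fun n => ∫ x, φ n x * ψ n x ∂μ) atTop (𝓝 (∫ x, f x * g x ∂μ)) := by
  have t1 : Tendsto (fun n => (hφ n).toLp (φ n)) atTop (𝓝 (hf.toLp f)) :=
    (Lp.tendsto_Lp_iff_tendsto_eLpNorm'' _ hφ _ hf).2 h1
  have t2 : Tendsto (fun n => (hψ n).toLp (ψ n)) atTop (𝓝 (hg.toLp g)) :=
    (Lp.tendsto_Lp_iff_tendsto_eLpNorm'' _ hψ _ hg).2 h2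
  have := t1.inner (𝕜 := ℝ) t2
  simpa only [inner_toLp_toLp] using this

end L2

/-! ### Step functions in `L²` -/

section StepFun

theorem setIntegral_Icc_eq (T : ℝ≥0) (f : ℝ → ℝ) :
    ∫ t in Icc (0 : ℝ) T, f t = ∫ t in (0 : ℝ)..T, f t := by
  rw [integral_Icc_eq_integral_Ioc, intervalIntegral.integral_of_le T.coe_nonneg]

variable {T : ℝ≥0}

theorem StepFun.memLp (φ : StepFun T) (p : ℝ≥0∞) :
    MemLp φ.toFun p (volume.restrict (Icc (0 : ℝ) (T : ℝ))) := by
  unfold StepFun.toFun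
  refine memLp_finsetSum _ fun i _ => memLp_indicator_const p measurableSet_Ioc _ (Or.inr ?_)
  exact measure_ne_top _ _

theorem StepFun.integral_mul (φ : StepFun T) {b : ℝ → ℝ}
    (hb : IntegrableOn b (Icc (0 : ℝ) (T : ℝ))) :
    ∫ t in Icc (0 : ℝ) T, φ.toFun t * b t
      = ∑ i, φ.coeff i * ∫ t in (φ.lo i : ℝ)..(φ.hi i), b t := by
  have e : ∀ t, φ.toFun t * b t
      = ∑ i, φ.coeff i * (Ioc (φ.lo i : ℝ) (φ.hi i)).indicator b t := by
    intro t
    rw [StepFun.toFun, Finset.sum_mul]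
    refine Finset.sum_congr rfl fun i _ => ?_
    by_cases h : t ∈ Ioc (φ.lo i : ℝ) (φ.hi i)
    · rw [indicator_of_mem h, indicator_of_mem h]
    · rw [indicator_of_notMem h, indicator_of_notMem h]; simp
  simp_rw [e]
  rw [integral_finsetSum _ fun i _ => (Integrable.indicator hb measurableSet_Ioc).const_mul _]
  refine Finset.sum_congr rfl fun i _ => ?_
  rw [integral_const_mul, setIntegral_indicator measurableSet_Ioc,
    intervalIntegral.integral_of_le (by exact_mod_cast φ.lo_le_hi i), inter_eq_self_of_subset_right]
  intro t ht
  exact ⟨(NNReal.coe_nonneg _).trans ht.1.le, ht.2.trans (by exact_mod_cast φ.hi_le i)⟩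

theorem integral_Ioc_indicator {a b c d : ℝ} (hab : a ≤ b) (hcd : c ≤ d) :
    ∫ t in c..d, (Ioc a b).indicator (fun _ => (1 : ℝ)) t
      = min b d - min b c - min a d + min a c := by
  rw [intervalIntegral.integral_of_le hcd, setIntegral_indicator measurableSet_Ioc, Ioc_inter_Ioc,
    setIntegral_const, smul_eq_mul, mul_one, Real.volume_real_Ioc]
  rcases le_total b d with h1 | h1 <;> rcases le_total b c with h2 | h2 <;>
  rcases le_total a d with h3 | h3 <;> rcases le_total a c with h4 | h4 <;>
  simp only [h1, h2, h3, h4, max_eq_left, max_eq_right, min_eq_left, min_eq_right] <;>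
  first
  | (rw [max_eq_left (by linarith)]; linarith)
  | (rw [max_eq_right (by linarith)]; linarith)

/-- The `L²` product of step functions, in terms of the covariances `min s t` of Brownian motion. -/
theorem StepFun.integral_mul_toFun (φ ψ : StepFun T) :
    ∫ t in Icc (0 : ℝ) T, φ.toFun t * ψ.toFun t
      = ∑ i, ∑ j, φ.coeff i * ψ.coeff j * ((min (ψ.hi j : ℝ) (φ.hi i) - min (ψ.hi j : ℝ) (φ.lo i)
        - min (ψ.lo j : ℝ) (φ.hi i) + min (ψ.lo j : ℝ) (φ.lo i))) := by
  rw [φ.integral_mul (memLp_one_iff_integrable.1 (ψ.memLp 1))]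
  refine Finset.sum_congr rfl fun i _ => ?_
  have hint : ∀ j, IntervalIntegrable
      ((Ioc (ψ.lo j : ℝ) (ψ.hi j)).indicator fun _ => ψ.coeff j) volume (φ.lo i) (φ.hi i) :=
    fun j => ⟨(intervalIntegrable_const (c := ψ.coeff j)).1.indicator measurableSet_Ioc,
      (intervalIntegrable_const (c := ψ.coeff j)).2.indicator measurableSet_Ioc⟩
  unfold StepFun.toFun
  rw [intervalIntegral.integral_finsetSum fun j _ => hint j, Finset.mul_sum]
  refine Finset.sum_congr rfl fun j _ => ?_
  rw [mul_assoc, ← integral_Ioc_indicator (by exact_mod_cast ψ.lo_le_hi j)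
    (by exact_mod_cast φ.lo_le_hi i)]
  congr 1
  rw [← intervalIntegral.integral_const_mul]
  refine intervalIntegral.integral_congr fun t _ => ?_
  by_cases h : t ∈ Ioc (ψ.lo j : ℝ) (ψ.hi j)
  · simp [indicator_of_mem h]
  · simp [indicator_of_notMem h]

end StepFun

/-! ### The Wiener integral of deterministic functions -/

section Wiener

variable {T : ℝ≥0} {Ω : Type*} [MeasurableSpace Ω] {P : Measure Ω} {W : ℝ≥0 → Ω → ℝ}

theorem StepFun.hasGaussianLaw_integral (hW : IsPreBrownianReal W P) (φ : StepFun T) :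
    HasGaussianLaw (φ.integral W) P := by
  classical
  have h : IsGaussianProcess (fun (i : Fin φ.n) ω =>
      φ.coeff i * (W (φ.hi i) ω - W (φ.lo i) ω)) P :=
    hW.isGaussianProcess.of_isGaussianProcess fun i => ⟨{φ.hi i, φ.lo i},
      { toFun x := φ.coeff i * (x ⟨φ.hi i, by simp⟩ - x ⟨φ.lo i, by simp⟩)
        map_add' x y := by simp; ring
        map_smul' m x := by simp; ring }, by simp⟩
  exact h.hasGaussianLaw_fun_sum (I := Finset.univ)

theorem StepFun.expectation_integral (hW : IsPreBrownianReal W P) (φ : StepFun T) :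
    P[φ.integral W] = 0 := by
  have hi : ∀ i, Integrable (fun ω => φ.coeff i * (W (φ.hi i) ω - W (φ.lo i) ω)) P := fun i =>
    ((hW.integrable_eval _).sub (hW.integrable_eval _)).const_mul _
  unfold StepFun.integral
  rw [integral_finsetSum _ fun i _ => hi i]
  refine Finset.sum_eq_zero fun i _ => ?_
  rw [integral_const_mul, integral_sub (hW.integrable_eval _) (hW.integrable_eval _),
    hW.integral_eval, hW.integral_eval]
  simp

/-- The Ito isometry for step functions. -/
theorem StepFun.covariance_integral [IsProbabilityMeasure P] (hW : IsPreBrownianReal W P)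
    (φ ψ : StepFun T) :
    cov[φ.integral W, ψ.integral W; P] = ∫ t in Icc (0 : ℝ) T, φ.toFun t * ψ.toFun t := by
  have m : ∀ t, MemLp (W t) 2 P := fun t =>
    (hW.isGaussianProcess.hasGaussianLaw_eval t).memLp_two
  rw [StepFun.integral_mul_toFun]
  unfold StepFun.integral
  have hi : ∀ (φ : StepFun T) i,
      MemLp (fun ω => φ.coeff i * (W (φ.hi i) ω - W (φ.lo i) ω)) 2 P := fun φ i =>
    ((m _).sub (m _)).const_mul _
  rw [covariance_fun_sum_fun_sum (hi φ) (hi ψ)]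
  refine Finset.sum_congr rfl fun i _ => Finset.sum_congr rfl fun j _ => ?_
  rw [covariance_const_mul_left, covariance_const_mul_right,
    covariance_fun_sub_fun_sub (m _) (m _) (m _) (m _)]
  simp only [hW.covariance_fun_eval, NNReal.coe_min]
  rw [min_comm (φ.hi i : ℝ), min_comm (φ.hi i : ℝ), min_comm (φ.lo i : ℝ), min_comm (φ.lo i : ℝ)]
  ring

theorem StepFun.variance_integral [IsProbabilityMeasure P] (hW : IsPreBrownianReal W P)
    (φ : StepFun T) :
    Var[φ.integral W; P] = ∫ t in Icc (0 : ℝ) T, φ.toFun t * φ.toFun t := by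
  rw [← φ.covariance_integral hW φ, covariance_self (φ.hasGaussianLaw_integral hW).aemeasurable]

theorem StepFun.variance_integral_sub [IsProbabilityMeasure P] (hW : IsPreBrownianReal W P)
    (φ ψ : StepFun T) :
    Var[φ.integral W - ψ.integral W; P]
      = ∫ t in Icc (0 : ℝ) T, (φ.toFun t - ψ.toFun t) * (φ.toFun t - ψ.toFun t) := by
  have i1 : ∀ φ ψ : StepFun T, Integrable (fun t => φ.toFun t * ψ.toFun t)
      (volume.restrict (Icc (0 : ℝ) (T : ℝ))) := fun φ ψ =>
    (φ.memLp 2).integrable_mul (ψ.memLp 2)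
  rw [variance_sub (φ.hasGaussianLaw_integral hW).memLp_two
    (ψ.hasGaussianLaw_integral hW).memLp_two, φ.variance_integral hW, ψ.variance_integral hW,
    φ.covariance_integral hW ψ]
  have e : ∀ t, (φ.toFun t - ψ.toFun t) * (φ.toFun t - ψ.toFun t) = φ.toFun t * φ.toFun t
      - 2 * (φ.toFun t * ψ.toFun t) + ψ.toFun t * ψ.toFun t := fun t => by ring
  have i2 : Integrable (fun t => φ.toFun t * φ.toFun t - 2 * (φ.toFun t * ψ.toFun t))
      (volume.restrict (Icc (0 : ℝ) (T : ℝ))) := (i1 _ _).sub ((i1 _ _).const_mul _)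
  simp_rw [e]
  rw [integral_add i2 (i1 _ _), integral_sub (i1 _ _) ((i1 _ _).const_mul _), integral_const_mul]

theorem _root_.Continuous.memLp_Icc {f : ℝ → ℝ} (hf : Continuous f) (T : ℝ) (p : ℝ≥0∞) :
    MemLp f p (volume.restrict (Icc (0 : ℝ) T)) := by
  obtain ⟨C, hC⟩ := isCompact_Icc.exists_bound_of_continuousOn (hf.continuousOn (s := Icc 0 T))
  refine MemLp.of_bound hf.aestronglyMeasurable C ?_
  filter_upwards [ae_restrict_mem measurableSet_Icc] with t ht using hC t ht

theorem IsPrimitive.memLp {f g : ℝ → ℝ} (h : IsPrimitive T f g) (p : ℝ≥0∞) :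
    MemLp f p (volume.restrict (Icc (0 : ℝ) (T : ℝ))) :=
  h.continuous.memLp_Icc T p

/-- Elementary integrals with the same `L²` limit of the integrands have the same limit in
probability. -/
theorem tendstoInMeasure_integral_sub [IsProbabilityMeasure P] (hW : IsPreBrownianReal W P)
    {f : ℝ → ℝ} (hf : MemLp f 2 (volume.restrict (Icc (0 : ℝ) (T : ℝ)))) {φ ψ : ℕ → StepFun T}
    (h1 : Tendsto (fun n => eLpNorm (fun t => (φ n).toFun t - f t) 2
      (volume.restrict (Icc (0 : ℝ) (T : ℝ)))) atTop (𝓝 0))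
    (h2 : Tendsto (fun n => eLpNorm (fun t => (ψ n).toFun t - f t) 2
      (volume.restrict (Icc (0 : ℝ) (T : ℝ)))) atTop (𝓝 0)) :
    TendstoInMeasure P (fun n => (φ n).integral W - (ψ n).integral W) atTop 0 := by
  have h3 : Tendsto (fun n => eLpNorm (fun t => ((φ n).toFun t - (ψ n).toFun t) - 0) 2
      (volume.restrict (Icc (0 : ℝ) (T : ℝ)))) atTop (𝓝 0) := by
    refine tendsto_of_tendsto_of_tendsto_of_le_of_le tendsto_const_nhds
      (by simpa using h1.add h2) (fun n => zero_le) fun n => ?_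
    have : (fun t => ((φ n).toFun t - (ψ n).toFun t) - 0)
        = (fun t => (φ n).toFun t - f t) - fun t => (ψ n).toFun t - f t := by
      ext t; simp
    rw [this]
    exact eLpNorm_sub_le (((φ n).memLp 2).sub hf).1 (((ψ n).memLp 2).sub hf).1 (by norm_num)
  have m : ∀ n, MemLp (fun t => (φ n).toFun t - (ψ n).toFun t) 2
      (volume.restrict (Icc (0 : ℝ) (T : ℝ))) := fun n => ((φ n).memLp 2).sub ((ψ n).memLp 2)
  have h4 := tendsto_integral_mul_of_tendsto_eLpNorm (g := fun _ => 0) (f := fun _ => 0)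
    m MemLp.zero m MemLp.zero h3 h3
  simp only [mul_zero, integral_zero] at h4
  rw [tendstoInMeasure_iff_norm]
  intro δ hδ
  have h5 : Tendsto (fun n => ENNReal.ofReal
      (Var[(φ n).integral W - (ψ n).integral W; P] / δ ^ 2)) atTop (𝓝 0) := by
    simp_rw [StepFun.variance_integral_sub hW]
    simpa using ENNReal.tendsto_ofReal (h4.div_const (δ ^ 2))
  refine tendsto_of_tendsto_of_tendsto_of_le_of_le tendsto_const_nhds h5 (fun n => zero_le)
    fun n => ?_
  have h6 := meas_ge_le_variance_div_sq (μ := P) (((φ n).hasGaussianLaw_integral hW).memLp_two.sub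
    ((ψ n).hasGaussianLaw_integral hW).memLp_two) hδ
  have h7 : P[(φ n).integral W - (ψ n).integral W] = 0 := by
    simp only [Pi.sub_apply]
    rw [integral_sub ((φ n).hasGaussianLaw_integral hW).integrable
      ((ψ n).hasGaussianLaw_integral hW).integrable, StepFun.expectation_integral hW,
      StepFun.expectation_integral hW, sub_zero]
  rw [h7] at h6
  simpa using h6

/-- Under the observation `dX = b dt + ε dW`, a stochastic integral of `f` is the sum of the
drift part and of the pathwise Wiener integral. -/
theorem IsStochIntegral.ae_eq [IsProbabilityMeasure P] (hW : IsBrownianReal W P)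
    {X : ℝ≥0 → Ω → ℝ} {ε : ℝ} {b f g : ℝ → ℝ} {I : Ω → ℝ} (hb : Continuous b)
    (hX : ∀ᵐ ω ∂P, ∀ t : ℝ≥0, t ≤ T → X t ω = (∫ s in (0 : ℝ)..(t : ℝ), b s) + ε * W t ω)
    (hfg : IsPrimitive T f g) (hI : IsStochIntegral P T X f I) :
    ∀ᵐ ω ∂P, I ω = (∫ t in (0 : ℝ)..T, f t * b t)
      + ε * pathIntegral T f g (fun t => W t ω) := by
  obtain ⟨φ, hφ, hφI⟩ := hI
  have hbm := hb.memLp_Icc T 2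
  have hdrift := tendsto_integral_mul_of_tendsto_eLpNorm (fun n => (φ n).memLp 2) (hfg.memLp 2)
    (fun _ => hbm) hbm hφ (by simp)
  -- along a subsequence, the elementary integrals differ from the Riemann sums by a null sequence
  -- almost surely, and the Riemann sums converge along every path
  obtain ⟨ns, hns, hns'⟩ := (tendstoInMeasure_integral_sub hW.toIsPreBrownianReal (hfg.memLp 2) hφ
    (tendsto_eLpNorm_riemannStep hfg.continuous.continuousOn)).exists_seq_tendsto_ae
  obtain ⟨ms, hms, hms'⟩ := (hφI.comp hns.tendsto_atTop).exists_seq_tendsto_ae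
  filter_upwards [hX, hns', hms', hW.cont, hW.eval_zero_ae_eq_zero] with ω h1 h2 h3 h4 h5
  have hT : Tendsto (fun n => ns (ms n)) atTop atTop :=
    hns.tendsto_atTop.comp hms.tendsto_atTop
  refine tendsto_nhds_unique h3 ?_
  have h6 := (h2.comp hms.tendsto_atTop).add ((tendsto_riemannStep_integral hfg h4 h5).comp hT)
  have h7 := (hdrift.comp hT).add (h6.const_mul ε)
  rw [setIntegral_Icc_eq T fun t => f t * b t] at h7
  simp only [Pi.zero_apply, zero_add] at h7
  refine h7.congr fun n => ?_
  simp only [Function.comp_apply, Pi.sub_apply, sub_add_cancel]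
  rw [StepFun.integral_mul _ (memLp_one_iff_integrable.1 (hb.memLp_Icc T 1))]
  unfold StepFun.integral
  rw [Finset.mul_sum, ← Finset.sum_add_distrib]
  refine Finset.sum_congr rfl fun i _ => ?_
  rw [h1 _ ((φ _).hi_le i), h1 _ (((φ _).lo_le_hi i).trans ((φ _).hi_le i)),
    ← intervalIntegral.integral_interval_sub_left (hb.intervalIntegrable _ _)
      (hb.intervalIntegrable _ _)]
  ring

/-- The pathwise Wiener integral of `f` is centred Gaussian with variance `∫_0^T f²`. -/
theorem hasLaw_pathIntegral [IsProbabilityMeasure P] (hW : IsBrownianReal W P) {f g : ℝ → ℝ}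
    (hfg : IsPrimitive T f g) :
    HasLaw (fun ω => pathIntegral T f g fun t => W t ω)
      (gaussianReal 0 (∫ t in (0 : ℝ)..T, f t ^ 2).toNNReal) P := by
  have hlim : ∀ᵐ ω ∂P, Tendsto (fun n => (riemannStep T f n).integral W ω) atTop
      (𝓝 (pathIntegral T f g fun t => W t ω)) := by
    filter_upwards [hW.cont, hW.eval_zero_ae_eq_zero] with ω h4 h5
    exact tendsto_riemannStep_integral hfg h4 h5
  have hG := fun n => (riemannStep T f n).hasGaussianLaw_integral hW.toIsPreBrownianReal
  have hmeas : AEMeasurable (fun ω => pathIntegral T f g fun t => W t ω) P :=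
    aemeasurable_of_tendsto_metrizable_ae atTop (fun n => (hG n).aemeasurable) hlim
  have hvar : Tendsto (fun n => Var[(riemannStep T f n).integral W; P]) atTop
      (𝓝 (∫ t in (0 : ℝ)..T, f t ^ 2)) := by
    simp_rw [StepFun.variance_integral hW.toIsPreBrownianReal]
    have hφ := tendsto_eLpNorm_riemannStep (T := T) hfg.continuous.continuousOn
    have := tendsto_integral_mul_of_tendsto_eLpNorm (fun n => (riemannStep T f n).memLp 2)
      (hfg.memLp 2) (fun n => (riemannStep T f n).memLp 2) (hfg.memLp 2) hφ hφ
    rw [setIntegral_Icc_eq T fun t => f t * f t] at this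
    simpa only [← sq] using this
  refine ⟨hmeas, ?_⟩
  have := Measure.isProbabilityMeasure_map (μ := P) hmeas
  -- the characteristic functions of the Gaussian Riemann sums converge on both sides
  refine Measure.ext_of_charFun ?_
  ext s
  have e : ∀ (Y : Ω → ℝ), AEMeasurable Y P →
      charFun (P.map Y) s = ∫ ω, Complex.exp (s * Y ω * Complex.I) ∂P := by
    intro Y hY
    rw [charFun_apply_real, integral_map hY (by fun_prop)]
  have c1 : Tendsto (fun n => charFun (P.map ((riemannStep T f n).integral W)) s) atTop
      (𝓝 (charFun (P.map fun ω => pathIntegral T f g fun t => W t ω) s)) := by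
    simp_rw [e _ (hG _).aemeasurable, e _ hmeas]
    refine tendsto_integral_of_dominated_convergence (fun _ => 1) (fun n => ?_)
      (integrable_const _) (fun n => ?_) ?_
    · have := (hG n).aemeasurable
      exact (by fun_prop : AEMeasurable _ P).aestronglyMeasurable
    · filter_upwards with ω
      rw [← Complex.ofReal_mul, Complex.norm_exp_ofReal_mul_I]
    · filter_upwards [hlim] with ω hω
      exact ((by fun_prop : Continuous fun x : ℝ => Complex.exp (s * x * Complex.I)).tendsto _).comp
        hω
  have c2 : Tendsto (fun n => charFun (P.map ((riemannStep T f n).integral W)) s) atTop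
      (𝓝 (charFun (gaussianReal 0 (∫ t in (0 : ℝ)..T, f t ^ 2).toNNReal) s)) := by
    simp_rw [(hG _).map_eq_gaussianReal, StepFun.expectation_integral hW.toIsPreBrownianReal,
      charFun_gaussianReal]
    have h : Continuous fun v : ℝ =>
        Complex.exp (s * (0 : ℝ) * Complex.I - (v.toNNReal : ℝ) * s ^ 2 / 2) := by
      have : Continuous fun v : ℝ => ((v.toNNReal : ℝ) : ℂ) :=
        Complex.continuous_ofReal.comp (NNReal.continuous_coe.comp continuous_real_toNNReal)
      fun_prop
    exact (h.tendsto _).comp hvar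
  exact tendsto_nhds_unique c1 c2

end Wiener

/-! ### Tightness of weighted norms of the Brownian path -/

section Tightness

variable {T : ℝ≥0} {Ω : Type*} [MeasurableSpace Ω] {P : Measure Ω} {W : ℝ≥0 → Ω → ℝ}

theorem integral_abs_eval_le [IsProbabilityMeasure P] (hW : IsPreBrownianReal W P) (t : ℝ≥0) :
    ∫ ω, |W t ω| ∂P ≤ 1 + t := by
  have m : MemLp (W t) 2 P := (hW.isGaussianProcess.hasGaussianLaw_eval t).memLp_two
  have h2 : ∫ ω, W t ω ^ 2 ∂P = t := by
    rw [← variance_of_integral_eq_zero (hW.aemeasurable t) (hW.integral_eval t),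
      ← covariance_self (hW.aemeasurable t), hW.covariance_eval, min_self]
  calc ∫ ω, |W t ω| ∂P ≤ ∫ ω, (1 + W t ω ^ 2) ∂P := by
        refine integral_mono (hW.integrable_eval t).abs ((integrable_const _).add m.integrable_sq)
          fun ω => ?_
        change |W t ω| ≤ 1 + W t ω ^ 2
        rw [← sq_abs]
        nlinarith [sq_nonneg (|W t ω| - 1), abs_nonneg (W t ω)]
    _ = 1 + t := by
        rw [integral_add (integrable_const _) m.integrable_sq, h2]
        simp

/-- A weighted `L¹` norm of a path, which dominates its Wiener integrals. -/
noncomputable def pathNorm (T : ℝ≥0) (C : ℝ) (h : ℝ → ℝ) (w : ℝ≥0 → ℝ) : ℝ :=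
  C * |w T| + ∫ t in (0 : ℝ)..T, |w t.toNNReal| * h t

/-- Markov's inequality for the weighted norm of the Brownian path: the bound does not depend on
the probability space. The expectation is estimated by Fatou's lemma along Riemann sums, so that no
joint measurability of the paths is needed. -/
theorem measure_le_pathNorm_le [IsProbabilityMeasure P] (hW : IsBrownianReal W P) {C : ℝ}
    (hC : 0 ≤ C) {h : ℝ → ℝ} (hh : IntervalIntegrable h volume 0 T) (h0 : ∀ t, 0 ≤ h t)
    {M : ℝ} (hM : 0 < M) :
    P {ω | M ≤ pathNorm T C h fun t => W t ω}
      ≤ ENNReal.ofReal ((1 + T) * (C + ∫ t in (0 : ℝ)..T, h t) / M) := by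
  have hB := hW.toIsPreBrownianReal
  -- the Riemann sums of the weighted norm, which converge to it along continuous paths
  set F : ℕ → Ω → ℝ := fun n ω => C * |W T ω| + ∑ i ∈ Finset.range n, |W (grid T n (i + 1)) ω|
    * ∫ t in (grid T n i : ℝ)..(grid T n (i + 1)), h t with hF
  have hcell : ∀ n i, 0 ≤ ∫ t in (grid T n i : ℝ)..(grid T n (i + 1)), h t := fun n i =>
    intervalIntegral.integral_nonneg (by exact_mod_cast grid_mono T n (Nat.le_succ i))
      fun t _ => h0 t
  have hF0 : ∀ n ω, 0 ≤ F n ω := fun n ω => add_nonneg (mul_nonneg hC (abs_nonneg _))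
    (Finset.sum_nonneg fun i _ => mul_nonneg (abs_nonneg _) (hcell n i))
  have hFi : ∀ n, Integrable (F n) P := fun n => ((hB.integrable_eval T).abs.const_mul C).add
    (integrable_finsetSum _ fun i _ => (hB.integrable_eval _).abs.mul_const _)
  have hFle : ∀ n, n ≠ 0 → ∫ ω, F n ω ∂P ≤ (1 + T) * (C + ∫ t in (0 : ℝ)..T, h t) := by
    intro n hn
    have e : ∫ t in (0 : ℝ)..T, h t = ∑ i ∈ Finset.range n,
        ∫ t in (grid T n i : ℝ)..(grid T n (i + 1)), h t := by
      rw [intervalIntegral.sum_integral_adjacent_intervals (a := fun i => (grid T n i : ℝ))]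
      · simp [grid_self T hn]
      · intro i hi
        refine hh.mono_set ?_
        rw [uIcc_of_le (by exact_mod_cast grid_mono T n (Nat.le_succ i)), uIcc_of_le T.coe_nonneg]
        exact Icc_subset_Icc (NNReal.coe_nonneg _) (by exact_mod_cast grid_le T hi)
    rw [hF]
    rw [integral_add ((hB.integrable_eval T).abs.const_mul C)
      (integrable_finsetSum _ fun i _ => (hB.integrable_eval _).abs.mul_const _),
      integral_const_mul, integral_finsetSum _ fun i _ => (hB.integrable_eval _).abs.mul_const _,
      e, mul_add, Finset.mul_sum]
    refine add_le_add ?_ (Finset.sum_le_sum fun i hi => ?_)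
    · rw [mul_comm]
      exact mul_le_mul_of_nonneg_right (integral_abs_eval_le hB T) hC
    · rw [integral_mul_const]
      refine mul_le_mul_of_nonneg_right ((integral_abs_eval_le hB _).trans ?_) (hcell n i)
      have : grid T n (i + 1) ≤ T := grid_le T (Finset.mem_range.1 hi)
      gcongr
  have hlim : ∀ᵐ ω ∂P, Tendsto (fun n => ENNReal.ofReal (F n ω)) atTop
      (𝓝 (ENNReal.ofReal (pathNorm T C h fun t => W t ω))) := by
    filter_upwards [hW.cont] with ω hω
    have hv : ContinuousOn (fun t : ℝ => |W t.toNNReal ω|) (Icc 0 (T : ℝ)) :=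
      (hω.comp continuous_real_toNNReal).abs.continuousOn
    have := (tendsto_sum_mul_integral hv hh).const_add (C * |W T ω|)
    simp only [Real.toNNReal_coe] at this
    exact ENNReal.tendsto_ofReal this
  have hmeas : AEMeasurable (fun ω => ENNReal.ofReal (pathNorm T C h fun t => W t ω)) P :=
    aemeasurable_of_tendsto_metrizable_ae atTop
      (fun n => (hFi n).aemeasurable.ennreal_ofReal) hlim
  have hE : ∫⁻ ω, ENNReal.ofReal (pathNorm T C h fun t => W t ω) ∂P
      ≤ ENNReal.ofReal ((1 + T) * (C + ∫ t in (0 : ℝ)..T, h t)) := by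
    calc ∫⁻ ω, ENNReal.ofReal (pathNorm T C h fun t => W t ω) ∂P
        = ∫⁻ ω, liminf (fun n => ENNReal.ofReal (F n ω)) atTop ∂P :=
          lintegral_congr_ae (hlim.mono fun ω hω => hω.liminf_eq.symm)
      _ ≤ liminf (fun n => ∫⁻ ω, ENNReal.ofReal (F n ω) ∂P) atTop :=
          lintegral_liminf_le' fun n => (hFi n).aemeasurable.ennreal_ofReal
      _ ≤ _ := by
          refine liminf_le_of_le (by isBoundedDefault) fun b hb => ?_
          obtain ⟨n, hn, hn0⟩ := (hb.and (eventually_ne_atTop 0)).exists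
          refine hn.trans ?_
          rw [← ofReal_integral_eq_lintegral_ofReal (hFi n) (ae_of_all _ (hF0 n))]
          exact ENNReal.ofReal_le_ofReal (hFle n hn0)
  have hMk := mul_meas_ge_le_lintegral₀ hmeas (ENNReal.ofReal M)
  rw [ENNReal.ofReal_div_of_pos hM, ENNReal.le_div_iff_mul_le
    (Or.inl (by simpa using hM)) (Or.inl ENNReal.ofReal_ne_top), mul_comm]
  refine le_trans ?_ (hMk.trans hE)
  gcongr
  intro h
  exact ENNReal.ofReal_le_ofReal h

theorem abs_pathIntegral_le {f g h : ℝ → ℝ} {C : ℝ} {w : ℝ≥0 → ℝ} (hw : Continuous w)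
    (hg : IntervalIntegrable g volume 0 T) (hh : IntervalIntegrable h volume 0 T)
    (hf : |f T| ≤ C) (hgh : ∀ t ∈ Icc 0 (T : ℝ), |g t| ≤ h t) :
    |pathIntegral T f g w| ≤ pathNorm T C h w := by
  have hc : Continuous fun t : ℝ => w t.toNNReal := hw.comp continuous_real_toNNReal
  unfold pathIntegral pathNorm
  refine (abs_sub _ _).trans (add_le_add ?_ ?_)
  · rw [abs_mul]
    exact mul_le_mul_of_nonneg_right hf (abs_nonneg _)
  · refine (intervalIntegral.abs_integral_le_integral_abs T.coe_nonneg).trans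
      (intervalIntegral.integral_mono_on T.coe_nonneg
        (hg.continuousOn_mul hc.continuousOn).abs (hh.continuousOn_mul hc.abs.continuousOn)
        fun t ht => ?_)
    rw [abs_mul]
    exact mul_le_mul_of_nonneg_left (hgh t ht) (abs_nonneg _)

end Tightness

/-! ### A second order Taylor estimate -/

/-- Taylor's formula of second order at any two points of the interval, in either order. The
constant is not optimal: it comes from applying the mean value inequality twice. -/
theorem abs_taylor_two_le {F F' F'' : ℝ → ℝ} {k K M : ℝ}
    (h1 : ∀ x ∈ Icc k K, HasDerivAt F (F' x) x) (h2 : ∀ x ∈ Icc k K, HasDerivAt F' (F'' x) x)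
    (hM : ∀ x ∈ Icc k K, |F'' x| ≤ M) {x y : ℝ} (hx : x ∈ Icc k K) (hy : y ∈ Icc k K) :
    |F x - F y - (x - y) * F' y| ≤ M * (x - y) ^ 2 := by
  have hM0 : 0 ≤ M := (abs_nonneg _).trans (hM x hx)
  have hsub : uIcc y x ⊆ Icc k K := by
    rw [← uIcc_of_le (hx.1.trans hx.2)]
    exact uIcc_subset_uIcc (by rwa [uIcc_of_le (hx.1.trans hx.2)])
      (by rwa [uIcc_of_le (hx.1.trans hx.2)])
  have b1 : ∀ z ∈ uIcc y x, |F' z - F' y| ≤ M * |x - y| := fun z hz => by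
    have := (convex_uIcc y x).norm_image_sub_le_of_norm_hasDerivWithin_le
      (fun z hz => (h2 z (hsub hz)).hasDerivWithinAt) (fun z hz => hM z (hsub hz))
      left_mem_uIcc hz
    refine this.trans (mul_le_mul_of_nonneg_left ?_ hM0)
    exact abs_sub_left_of_mem_uIcc hz
  have := (convex_uIcc y x).norm_image_sub_le_of_norm_hasDerivWithin_le
    (f := fun z => F z - z * F' y) (f' := fun z => F' z - 1 * F' y)
    (fun z hz => ((h1 z (hsub hz)).sub ((hasDerivAt_id z).mul_const _)).hasDerivWithinAt)
    (C := M * |x - y|) (fun z hz => by rw [one_mul]; exact b1 z hz) left_mem_uIcc right_mem_uIcc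
  rw [Real.norm_eq_abs, Real.norm_eq_abs, mul_assoc, ← sq, sq_abs] at this
  refine le_of_eq_of_le ?_ this
  congr 1
  ring

/-! ### Powers as functions of the exponent -/

section Power

theorem hasDerivAt_rpow_exponent {x : ℝ} (hx : 0 < x) (κ : ℝ) :
    HasDerivAt (fun κ => x ^ κ) (x ^ κ * Real.log x) κ :=
  (Real.hasStrictDerivAt_const_rpow hx κ).hasDerivAt

/-- On `[0, L]` the powers with exponents in `[k, K]` are dominated by the lowest one. -/
theorem rpow_le_mul_rpow {x L k K κ : ℝ} (hx : 0 ≤ x) (hxL : x ≤ L) (hL : 1 ≤ L) (hk : 0 < k)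
    (hκ : κ ∈ Icc k K) : x ^ κ ≤ L ^ (K - k) * x ^ k := by
  have : x ^ κ = x ^ (κ - k) * x ^ k := by
    rw [← Real.rpow_add_of_nonneg hx (sub_nonneg.2 hκ.1) hk.le, sub_add_cancel]
  rw [this]
  refine mul_le_mul_of_nonneg_right ?_ (Real.rpow_nonneg hx _)
  calc x ^ (κ - k) ≤ L ^ (κ - k) := Real.rpow_le_rpow hx hxL (sub_nonneg.2 hκ.1)
    _ ≤ L ^ (K - k) := Real.rpow_le_rpow_of_exponent_le hL (by linarith [hκ.2])

theorem rpow_sub_one_le_mul_rpow {x L k K κ : ℝ} (hx : 0 < x) (hxL : x ≤ L) (hL : 1 ≤ L)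
    (hk : 0 < k) (hκ : κ ∈ Icc k K) : x ^ (κ - 1) ≤ L ^ (K - k) * x ^ (k - 1) := by
  rw [Real.rpow_sub_one hx.ne', Real.rpow_sub_one hx.ne', ← mul_div_assoc]
  exact div_le_div_of_nonneg_right (rpow_le_mul_rpow hx.le hxL hL hk hκ) hx.le

/-- On `[0, L]` the powers with exponents in `[k, K]` dominate the highest one. -/
theorem rpow_top_le_mul_rpow {x L k K κ : ℝ} (hx : 0 ≤ x) (hxL : x ≤ L) (hL : 1 ≤ L) (hk : 0 < k)
    (hκ : κ ∈ Icc k K) : x ^ K ≤ L ^ (K - k) * x ^ κ := by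
  have : x ^ K = x ^ (K - κ) * x ^ κ := by
    rw [← Real.rpow_add_of_nonneg hx (sub_nonneg.2 hκ.2) (hk.le.trans hκ.1), sub_add_cancel]
  rw [this]
  refine mul_le_mul_of_nonneg_right ?_ (Real.rpow_nonneg hx _)
  calc x ^ (K - κ) ≤ L ^ (K - κ) := Real.rpow_le_rpow hx hxL (sub_nonneg.2 hκ.2)
    _ ≤ L ^ (K - k) := Real.rpow_le_rpow_of_exponent_le hL (by linarith [hκ.1])

/-- Second order Taylor estimate for `κ ↦ x ^ κ`. -/
theorem abs_rpow_taylor_le {x L k K κ κ' : ℝ} (hx : 0 ≤ x) (hxL : x ≤ L) (hL : 1 ≤ L) (hk : 0 < k)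
    (hκ : κ ∈ Icc k K) (hκ' : κ' ∈ Icc k K) :
    |x ^ κ - x ^ κ' - (κ - κ') * (x ^ κ' * Real.log x)|
      ≤ L ^ (K - k) * (x ^ k * Real.log x ^ 2) * (κ - κ') ^ 2 := by
  rcases hx.eq_or_lt with rfl | hx
  · simp [Real.zero_rpow (hk.trans_le hκ.1).ne', Real.zero_rpow (hk.trans_le hκ'.1).ne']
  refine abs_taylor_two_le (F := fun κ => x ^ κ) (F' := fun κ => x ^ κ * Real.log x)
    (F'' := fun κ => x ^ κ * Real.log x * Real.log x)
    (fun y _ => hasDerivAt_rpow_exponent hx y)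
    (fun y _ => (hasDerivAt_rpow_exponent hx y).mul_const _) (fun y hy => ?_) hκ hκ'
  rw [mul_assoc, ← sq, abs_mul, abs_of_nonneg (sq_nonneg (Real.log x)),
    abs_of_pos (Real.rpow_pos_of_pos hx _), ← mul_assoc]
  exact mul_le_mul_of_nonneg_right (rpow_le_mul_rpow hx.le hxL hL hk hy) (sq_nonneg _)

/-- Second order Taylor estimate for `κ ↦ κ x ^ (κ - 1)`. -/
theorem abs_deriv_rpow_taylor_le {x L k K κ κ' : ℝ} (hx : 0 < x) (hxL : x ≤ L) (hL : 1 ≤ L)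
    (hk : 0 < k) (hκ : κ ∈ Icc k K) (hκ' : κ' ∈ Icc k K) :
    |κ * x ^ (κ - 1) - κ' * x ^ (κ' - 1) - (κ - κ') * (x ^ (κ' - 1) * (κ' * Real.log x + 1))|
      ≤ L ^ (K - k) * (x ^ (k - 1) * (2 * |Real.log x| + K * Real.log x ^ 2)) * (κ - κ') ^ 2 := by
  have hd : ∀ y : ℝ, HasDerivAt (fun κ => x ^ (κ - 1)) (x ^ (y - 1) * Real.log x) y := fun y =>
    (hasDerivAt_rpow_exponent hx (y - 1)).comp_sub_const y 1
  refine abs_taylor_two_le (F := fun κ => κ * x ^ (κ - 1))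
    (F' := fun κ => x ^ (κ - 1) * (κ * Real.log x + 1))
    (F'' := fun κ => x ^ (κ - 1) * (2 * Real.log x + κ * Real.log x ^ 2))
    (fun y _ => ?_) (fun y _ => ?_) (fun y hy => ?_) hκ hκ'
  · exact ((hasDerivAt_id y).mul (hd y)).congr_deriv (by simp only [id]; ring)
  · exact ((hd y).mul (((hasDerivAt_id y).mul_const (Real.log x)).add_const 1)).congr_deriv
      (by simp only [id]; ring)
  · have hy0 : 0 < y := hk.trans_le hy.1
    rw [abs_mul, abs_of_pos (Real.rpow_pos_of_pos hx _), ← mul_assoc]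
    refine mul_le_mul (rpow_sub_one_le_mul_rpow hx hxL hL hk hy) ?_ (abs_nonneg _)
      (mul_nonneg (Real.rpow_nonneg (by linarith) _) (Real.rpow_nonneg hx.le _))
    refine (abs_add_le _ _).trans (add_le_add ?_ ?_)
    · rw [abs_mul, abs_two]
    · rw [abs_mul, abs_of_pos hy0, abs_of_nonneg (sq_nonneg _)]
      exact mul_le_mul_of_nonneg_right hy.2 (sq_nonneg _)

/-- The powers `x ^ κ` separate the exponents, with a rate vanishing only at `x ∈ {0, 1}`. -/
theorem le_abs_rpow_sub {x L k K κ κ' : ℝ} (hx : 0 ≤ x) (hxL : x ≤ L) (hL : 1 ≤ L) (hk : 0 < k)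
    (hκ : κ ∈ Icc k K) (hκ' : κ' ∈ Icc k K) :
    |κ - κ'| * |x ^ K * Real.log x| ≤ L ^ (K - k) * |x ^ κ - x ^ κ'| := by
  rcases hx.eq_or_lt with rfl | hx
  · simp only [Real.log_zero, mul_zero, abs_zero]
    exact mul_nonneg (Real.rpow_nonneg (by linarith) _) (abs_nonneg _)
  have hA : 0 ≤ L ^ (K - k) := Real.rpow_nonneg (by linarith) _
  have key : ∀ p ∈ Icc k K, ∀ q ∈ Icc k K, Real.log x * p ≤ Real.log x * q →
      |q - p| * |x ^ K * Real.log x| ≤ L ^ (K - k) * |x ^ q - x ^ p| := by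
    intro p hp q hq hpq
    have e : x ^ p * (Real.log x * q - Real.log x * p) ≤ x ^ q - x ^ p := by
      have h1 := Real.add_one_le_exp (Real.log x * q - Real.log x * p)
      have h2 : x ^ q = x ^ p * Real.exp (Real.log x * q - Real.log x * p) := by
        rw [Real.rpow_def_of_pos hx, Real.rpow_def_of_pos hx, ← Real.exp_add]
        ring_nf
      rw [h2]
      nlinarith [Real.rpow_pos_of_pos hx p]
    have h0 : 0 ≤ Real.log x * q - Real.log x * p := sub_nonneg.2 hpq
    calc |q - p| * |x ^ K * Real.log x| = x ^ K * (Real.log x * q - Real.log x * p) := by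
          rw [abs_mul, abs_of_pos (Real.rpow_pos_of_pos hx _), ← abs_of_nonneg h0, ← mul_sub,
            abs_mul]
          ring
      _ ≤ L ^ (K - k) * x ^ p * (Real.log x * q - Real.log x * p) :=
          mul_le_mul_of_nonneg_right (rpow_top_le_mul_rpow hx.le hxL hL hk hp) h0
      _ ≤ L ^ (K - k) * |x ^ q - x ^ p| := by
          rw [mul_assoc]
          exact mul_le_mul_of_nonneg_left (e.trans (le_abs_self _)) hA
  rcases le_total (Real.log x * κ') (Real.log x * κ) with h | h
  · exact key _ hκ' _ hκ h
  · rw [abs_sub_comm κ, abs_sub_comm (x ^ κ)]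
    exact key _ hκ _ hκ' h

end Power

/-! ### Functions with a cusp -/

section Cusp

variable {ρ : ℝ}

theorem continuous_abs_sub_rpow (ρ : ℝ) {p : ℝ} (hp : 0 < p) : Continuous fun t => |t - ρ| ^ p :=
  (by fun_prop : Continuous fun t => |t - ρ|).rpow_const fun _ => Or.inr hp.le

/-- The continuity at `ρ` is that of `y log y` at `0`, since `x ^ p log x = p⁻¹ y log y` for
`y = x ^ p`. -/
theorem continuous_abs_sub_rpow_mul_log (ρ : ℝ) {p : ℝ} (hp : 0 < p) :
    Continuous fun t => |t - ρ| ^ p * Real.log |t - ρ| := by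
  have h := (Real.continuous_mul_log.comp (continuous_abs_sub_rpow ρ hp)).const_mul p⁻¹
  convert h using 2 with t
  simp only [Function.comp_apply]
  rcases (abs_nonneg (t - ρ)).eq_or_lt with h0 | h0
  · rw [← h0]
    simp [Real.zero_rpow hp.ne']
  · rw [Real.log_rpow h0]
    field_simp

theorem continuous_abs_sub_rpow_mul_log_sq (ρ : ℝ) {p : ℝ} (hp : 0 < p) :
    Continuous fun t => |t - ρ| ^ p * Real.log |t - ρ| ^ 2 := by
  have h := (continuous_abs_sub_rpow_mul_log ρ (half_pos hp)).pow 2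
  convert h using 2 with t
  rw [Pi.pow_apply, mul_pow, ← Real.rpow_mul_natCast (abs_nonneg _)]
  norm_num

theorem intervalIntegrable_abs_sub_rpow (ρ : ℝ) {p : ℝ} (hp : -1 < p) (a b : ℝ) :
    IntervalIntegrable (fun t => |t - ρ| ^ p) volume a b := by
  have h0 : ∀ c, IntervalIntegrable (fun t : ℝ => |t| ^ p) volume 0 c := by
    have hpos : ∀ c, 0 ≤ c → IntervalIntegrable (fun t : ℝ => |t| ^ p) volume 0 c := by
      intro c hc
      refine (intervalIntegral.intervalIntegrable_rpow' (a := 0) (b := c) hp).congr fun t ht => ?_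
      rw [uIoc_of_le hc] at ht
      simp only [abs_of_pos ht.1]
    intro c
    rcases le_total 0 c with hc | hc
    · exact hpos c hc
    · have := (hpos (-c) (by linarith)).comp_sub_left 0
      simpa using this
  have h1 : IntervalIntegrable (fun t : ℝ => |t| ^ p) volume (a - ρ) (b - ρ) :=
    (h0 _).symm.trans (h0 _)
  simpa using h1.comp_sub_right ρ

/-- The factor `x ^ (k / 2)` makes a logarithmic `y` continuous at `0`, and the other factor
`x ^ (k / 2 - 1)` is still integrable there. -/
theorem rpow_sub_one_mul_eq {x : ℝ} (hx : 0 ≤ x) (k : ℝ) {y : ℝ} (hy : x = 0 → y = 0) :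
    x ^ (k - 1) * y = x ^ (k / 2 - 1) * (x ^ (k / 2) * y) := by
  rcases hx.eq_or_lt with h0 | h0
  · simp [hy h0.symm]
  · rw [← mul_assoc, ← Real.rpow_add h0]
    ring_nf

theorem intervalIntegrable_abs_sub_rpow_mul_log (ρ : ℝ) {k : ℝ} (hk : 0 < k) (a b : ℝ) :
    IntervalIntegrable (fun t => |t - ρ| ^ (k - 1) * Real.log |t - ρ|) volume a b := by
  have h := (intervalIntegrable_abs_sub_rpow ρ (p := k / 2 - 1) (by linarith) a b).mul_continuousOn
    (continuous_abs_sub_rpow_mul_log ρ (half_pos hk)).continuousOn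
  refine h.congr fun t _ => (rpow_sub_one_mul_eq (abs_nonneg _) k fun h0 => ?_).symm
  rw [h0, Real.log_zero]

theorem intervalIntegrable_abs_sub_rpow_mul_log_sq (ρ : ℝ) {k : ℝ} (hk : 0 < k) (a b : ℝ) :
    IntervalIntegrable (fun t => |t - ρ| ^ (k - 1) * Real.log |t - ρ| ^ 2) volume a b := by
  have h := (intervalIntegrable_abs_sub_rpow ρ (p := k / 2 - 1) (by linarith) a b).mul_continuousOn
    (continuous_abs_sub_rpow_mul_log_sq ρ (half_pos hk)).continuousOn
  refine h.congr fun t _ => (rpow_sub_one_mul_eq (abs_nonneg _) k fun h0 => ?_).symm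
  rw [h0, Real.log_zero]
  norm_num

/-- A function of the distance to `ρ` which is continuous and smooth away from `ρ` is the primitive
of its derivative, provided that this is integrable. -/
theorem isPrimitive_comp_abs_sub (T : ℝ≥0) {F G : ℝ → ℝ} (hF : Continuous fun t => F |t - ρ|)
    (hG : ∀ x, 0 < x → HasDerivAt F (G x) x)
    (hGi : IntervalIntegrable (fun t => G |t - ρ|) volume 0 T) :
    IsPrimitive T (fun t => F |t - ρ|) (fun t => SignType.sign (t - ρ) * G |t - ρ|) := by
  have hd : ∀ t, t ≠ ρ →
      HasDerivAt (fun t => F |t - ρ|) (SignType.sign (t - ρ) * G |t - ρ|) t := by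
    intro t ht
    have h1 := (hasDerivAt_abs (sub_ne_zero.2 ht)).comp t ((hasDerivAt_id t).sub_const ρ)
    have h2 := (hG _ (abs_pos.2 (sub_ne_zero.2 ht))).comp t h1
    exact h2.congr_deriv (by ring)
  have hi : IntervalIntegrable (fun t => (SignType.sign (t - ρ) : ℝ) * G |t - ρ|) volume 0 T := by
    refine hGi.abs.mono_fun ?_ ?_
    · have hm : Measurable fun t : ℝ => ((SignType.sign (t - ρ) : SignType) : ℝ) := by
        have : (fun t : ℝ => ((SignType.sign (t - ρ) : SignType) : ℝ))
            = fun t => if ρ < t then 1 else if t < ρ then -1 else 0 := by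
          ext t
          rw [sign_apply]
          split_ifs <;> simp_all
        rw [this]
        exact Measurable.ite measurableSet_Ioi measurable_const
          (Measurable.ite measurableSet_Iio measurable_const measurable_const)
      exact hm.aestronglyMeasurable.mul hGi.def'.aestronglyMeasurable
    · filter_upwards with t
      rw [norm_mul, Real.norm_eq_abs, Real.norm_eq_abs, Real.norm_eq_abs, abs_abs]
      refine mul_le_of_le_one_left (abs_nonneg _) ?_
      rcases SignType.trichotomy (SignType.sign (t - ρ)) with h | h | h <;> rw [h] <;> simp
  refine ⟨hF, hi, fun s hs t ht => ?_⟩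
  refine MeasureTheory.integral_eq_of_hasDerivAt_off_countable _ _ (countable_singleton ρ)
    hF.continuousOn (fun x hx => hd x hx.2) (hi.mono_set ?_)
  rw [uIcc_of_le T.coe_nonneg]
  exact uIcc_subset_Icc hs ht

end Cusp

/-! ### The signal and its derivatives -/

section Signal

variable {T : ℝ≥0} {a ρ k K κ κ' : ℝ}

/-- The signal `a |t - ρ| ^ κ`. -/
noncomputable def signal (a ρ κ t : ℝ) : ℝ := a * |t - ρ| ^ κ

/-- The derivative of the signal in time, set to `0` at the cusp. -/
noncomputable def signalTimeDeriv (a ρ κ t : ℝ) : ℝ :=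
  SignType.sign (t - ρ) * (a * (κ * |t - ρ| ^ (κ - 1)))

/-- The derivative of the signal in the exponent. -/
noncomputable def score (a ρ κ t : ℝ) : ℝ := a * (|t - ρ| ^ κ * Real.log |t - ρ|)

/-- The derivative of the score in time, set to `0` at the cusp. -/
noncomputable def scoreTimeDeriv (a ρ κ t : ℝ) : ℝ :=
  SignType.sign (t - ρ) * (a * (|t - ρ| ^ (κ - 1) * (κ * Real.log |t - ρ| + 1)))

theorem continuous_signal (a ρ : ℝ) (hκ : 0 < κ) : Continuous (signal a ρ κ) :=
  (continuous_abs_sub_rpow ρ hκ).const_mul a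

theorem continuous_score (a ρ : ℝ) (hκ : 0 < κ) : Continuous (score a ρ κ) :=
  (continuous_abs_sub_rpow_mul_log ρ hκ).const_mul a

theorem isPrimitive_signal (T : ℝ≥0) (a ρ : ℝ) (hκ : 0 < κ) :
    IsPrimitive T (signal a ρ κ) (signalTimeDeriv a ρ κ) := by
  refine isPrimitive_comp_abs_sub T (F := fun x => a * x ^ κ)
    (G := fun x => a * (κ * x ^ (κ - 1))) (continuous_signal a ρ hκ) (fun x hx => ?_) ?_
  · exact (Real.hasDerivAt_rpow_const (Or.inl hx.ne')).const_mul a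
  · exact ((intervalIntegrable_abs_sub_rpow ρ (by linarith) _ _).const_mul κ).const_mul a

theorem isPrimitive_score (T : ℝ≥0) (a ρ : ℝ) (hκ : 0 < κ) :
    IsPrimitive T (score a ρ κ) (scoreTimeDeriv a ρ κ) := by
  refine isPrimitive_comp_abs_sub T (F := fun x => a * (x ^ κ * Real.log x))
    (G := fun x => a * (x ^ (κ - 1) * (κ * Real.log x + 1))) (continuous_score a ρ hκ)
    (fun x hx => ?_) ?_
  · refine (((Real.hasDerivAt_rpow_const (Or.inl hx.ne')).mul
      (Real.hasDerivAt_log hx.ne')).const_mul a).congr_deriv ?_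
    rw [Real.rpow_sub_one hx.ne']
    ring
  · refine IntervalIntegrable.const_mul ?_ a
    have h := ((intervalIntegrable_abs_sub_rpow_mul_log ρ hκ 0 T).const_mul κ).add
      (intervalIntegrable_abs_sub_rpow ρ (p := κ - 1) (by linarith) 0 T)
    refine h.congr fun t _ => ?_
    ring

/-- A bound, at least `1`, for the distance to `ρ` on `[0, T]`. -/
noncomputable def radius (T : ℝ≥0) (ρ : ℝ) : ℝ := 1 + T + |ρ|

theorem one_le_radius (T : ℝ≥0) (ρ : ℝ) : 1 ≤ radius T ρ := by
  unfold radius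
  linarith [T.coe_nonneg, abs_nonneg ρ]

theorem abs_sub_le_radius {t : ℝ} (ht : t ∈ Icc 0 (T : ℝ)) : |t - ρ| ≤ radius T ρ := by
  unfold radius
  have := abs_sub t ρ
  rw [abs_of_nonneg ht.1] at this
  linarith [ht.2]

theorem radius_rpow_pos (T : ℝ≥0) (ρ p : ℝ) : 0 < radius T ρ ^ p :=
  Real.rpow_pos_of_pos (by linarith [one_le_radius T ρ]) _

/-- The weight at the end point in the norm that controls the noise. -/
noncomputable def noiseConst (T : ℝ≥0) (a ρ k K : ℝ) : ℝ :=
  a * (radius T ρ ^ (K - k) * (|T - ρ| ^ k * (|Real.log (|T - ρ|)| + Real.log |T - ρ| ^ 2)))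

/-- The weight in the norm that controls the noise, uniformly in the exponent. It dominates both the
time derivative of the score and the second derivative in the exponent of that of the signal. -/
noncomputable def noiseWeight (T : ℝ≥0) (a ρ k K t : ℝ) : ℝ :=
  a * (radius T ρ ^ (K - k) * (|t - ρ| ^ (k - 1)
    * (1 + (K + 2) * |Real.log (|t - ρ|)| + K * Real.log |t - ρ| ^ 2)))

theorem noiseConst_nonneg (ha : 0 < a) : 0 ≤ noiseConst T a ρ k K := by
  have := radius_rpow_pos T ρ (K - k)
  unfold noiseConst
  positivity

theorem noiseWeight_nonneg (ha : 0 < a) (hK : 0 ≤ K) (t : ℝ) : 0 ≤ noiseWeight T a ρ k K t := by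
  have := radius_rpow_pos T ρ (K - k)
  unfold noiseWeight
  positivity

theorem intervalIntegrable_noiseWeight (T : ℝ≥0) (a ρ K : ℝ) (hk : 0 < k) :
    IntervalIntegrable (noiseWeight T a ρ k K) volume 0 T := by
  refine (IntervalIntegrable.const_mul ?_ _).const_mul a
  have h := ((intervalIntegrable_abs_sub_rpow ρ (p := k - 1) (by linarith) 0 T).add
    ((intervalIntegrable_abs_sub_rpow_mul_log ρ hk 0 T).abs.const_mul (K + 2))).add
    ((intervalIntegrable_abs_sub_rpow_mul_log_sq ρ hk 0 T).const_mul K)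
  refine h.congr fun t _ => ?_
  rw [abs_mul, abs_of_nonneg (Real.rpow_nonneg (abs_nonneg _) _)]
  ring

theorem abs_sign_mul_le {x b c : ℝ} (hc : 0 ≤ c) (h : x ≠ 0 → |b| ≤ c) :
    |(SignType.sign x : ℝ) * b| ≤ c := by
  rcases lt_trichotomy x 0 with hx | hx | hx
  · simpa [sign_neg hx] using h hx.ne
  · simpa [hx] using hc
  · simpa [sign_pos hx] using h hx.ne'

theorem abs_score_le (ha : 0 < a) (hk : 0 < k) (hκ : κ ∈ Icc k K) {t : ℝ}
    (ht : t ∈ Icc 0 (T : ℝ)) :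
    |score a ρ κ t| ≤ a * (radius T ρ ^ (K - k) * (|t - ρ| ^ k * |Real.log (|t - ρ|)|)) := by
  unfold score
  rw [abs_mul, abs_of_pos ha, abs_mul, abs_of_nonneg (Real.rpow_nonneg (abs_nonneg _) _),
    ← mul_assoc (radius T ρ ^ _)]
  exact mul_le_mul_of_nonneg_left (mul_le_mul_of_nonneg_right (rpow_le_mul_rpow (abs_nonneg _)
    (abs_sub_le_radius ht) (one_le_radius T ρ) hk hκ) (abs_nonneg _)) ha.le

theorem abs_signal_taylor_le (ha : 0 < a) (hk : 0 < k) (hκ : κ ∈ Icc k K) (hκ' : κ' ∈ Icc k K)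
    {t : ℝ} (ht : t ∈ Icc 0 (T : ℝ)) :
    |signal a ρ κ t - signal a ρ κ' t - (κ - κ') * score a ρ κ' t|
      ≤ a * (radius T ρ ^ (K - k) * (|t - ρ| ^ k * Real.log |t - ρ| ^ 2)) * (κ - κ') ^ 2 := by
  have e : signal a ρ κ t - signal a ρ κ' t - (κ - κ') * score a ρ κ' t
      = a * (|t - ρ| ^ κ - |t - ρ| ^ κ' - (κ - κ') * (|t - ρ| ^ κ' * Real.log |t - ρ|)) := by
    unfold signal score
    ring
  rw [e, abs_mul, abs_of_pos ha, mul_assoc]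
  exact mul_le_mul_of_nonneg_left (abs_rpow_taylor_le (abs_nonneg _)
    (abs_sub_le_radius ht) (one_le_radius T ρ) hk hκ hκ') ha.le

theorem abs_scoreTimeDeriv_le (ha : 0 < a) (hk : 0 < k) (hκ : κ ∈ Icc k K) {t : ℝ}
    (ht : t ∈ Icc 0 (T : ℝ)) : |scoreTimeDeriv a ρ κ t| ≤ noiseWeight T a ρ k K t := by
  have hκ0 : 0 < κ := hk.trans_le hκ.1
  have hK : 0 < K := hκ0.trans_le hκ.2
  refine abs_sign_mul_le (noiseWeight_nonneg ha hK.le t) fun h0 => ?_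
  have hR := radius_rpow_pos T ρ (K - k)
  have hx := abs_pos.2 h0
  unfold noiseWeight
  rw [abs_mul, abs_of_pos ha, abs_mul, abs_of_pos (Real.rpow_pos_of_pos hx _),
    ← mul_assoc (radius T ρ ^ _)]
  refine mul_le_mul_of_nonneg_left (mul_le_mul (rpow_sub_one_le_mul_rpow hx
    (abs_sub_le_radius ht) (one_le_radius T ρ) hk hκ) ?_ (abs_nonneg _) (by positivity)) ha.le
  have h1 : |κ * Real.log |t - ρ| + 1| ≤ κ * |Real.log (|t - ρ|)| + 1 := by
    refine (abs_add_le _ _).trans ?_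
    rw [abs_mul, abs_of_pos hκ0, abs_one]
  have h2 := mul_le_mul_of_nonneg_right hκ.2 (abs_nonneg (Real.log |t - ρ|))
  nlinarith [abs_nonneg (Real.log |t - ρ|), mul_nonneg hK.le (sq_nonneg (Real.log |t - ρ|))]

theorem abs_signalTimeDeriv_taylor_le (ha : 0 < a) (hk : 0 < k) (hκ : κ ∈ Icc k K)
    (hκ' : κ' ∈ Icc k K) {t : ℝ} (ht : t ∈ Icc 0 (T : ℝ)) :
    |signalTimeDeriv a ρ κ t - signalTimeDeriv a ρ κ' t - (κ - κ') * scoreTimeDeriv a ρ κ' t|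
      ≤ noiseWeight T a ρ k K t * (κ - κ') ^ 2 := by
  have hK : 0 < K := hk.trans_le (hκ.1.trans hκ.2)
  have e : signalTimeDeriv a ρ κ t - signalTimeDeriv a ρ κ' t
      - (κ - κ') * scoreTimeDeriv a ρ κ' t = SignType.sign (t - ρ) * (a *
        (κ * |t - ρ| ^ (κ - 1) - κ' * |t - ρ| ^ (κ' - 1)
          - (κ - κ') * (|t - ρ| ^ (κ' - 1) * (κ' * Real.log |t - ρ| + 1)))) := by
    unfold signalTimeDeriv scoreTimeDeriv
    ring
  rw [e]
  refine abs_sign_mul_le (mul_nonneg (noiseWeight_nonneg ha hK.le t) (sq_nonneg _)) fun h0 => ?_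
  have hR := radius_rpow_pos T ρ (K - k)
  have hx := abs_pos.2 h0
  unfold noiseWeight
  rw [abs_mul, abs_of_pos ha, mul_assoc]
  refine mul_le_mul_of_nonneg_left ((abs_deriv_rpow_taylor_le hx
    (abs_sub_le_radius ht) (one_le_radius T ρ) hk hκ hκ').trans ?_) ha.le
  refine mul_le_mul_of_nonneg_right (mul_le_mul_of_nonneg_left (mul_le_mul_of_nonneg_left ?_
    (Real.rpow_nonneg hx.le _)) hR.le) (sq_nonneg _)
  nlinarith [abs_nonneg (Real.log |t - ρ|), mul_nonneg hK.le (abs_nonneg (Real.log |t - ρ|))]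

end Signal

/-! ### The noise as a function of the exponent -/

section Noise

variable {T : ℝ≥0} {a ρ k K κ κ' : ℝ} {w : ℝ≥0 → ℝ}

/-- The noise `∫ a |t - ρ| ^ κ dw` in the log-likelihood at the exponent `κ`. -/
noncomputable def noise (T : ℝ≥0) (a ρ κ : ℝ) (w : ℝ≥0 → ℝ) : ℝ :=
  pathIntegral T (signal a ρ κ) (signalTimeDeriv a ρ κ) w

/-- The derivative of the noise in the exponent. -/
noncomputable def scoreNoise (T : ℝ≥0) (a ρ κ : ℝ) (w : ℝ≥0 → ℝ) : ℝ :=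
  pathIntegral T (score a ρ κ) (scoreTimeDeriv a ρ κ) w

/-- The random variable which controls the noise, uniformly in the exponent. -/
noncomputable def noiseBound (T : ℝ≥0) (a ρ k K : ℝ) (w : ℝ≥0 → ℝ) : ℝ :=
  pathNorm T (noiseConst T a ρ k K) (noiseWeight T a ρ k K) w

theorem abs_scoreNoise_le (ha : 0 < a) (hk : 0 < k) (hκ : κ ∈ Icc k K) (hw : Continuous w) :
    |scoreNoise T a ρ κ w| ≤ noiseBound T a ρ k K w := by
  refine abs_pathIntegral_le hw (isPrimitive_score T a ρ (hk.trans_le hκ.1)).integrable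
    (intervalIntegrable_noiseWeight T a ρ K hk) ?_ fun t ht => abs_scoreTimeDeriv_le ha hk hκ ht
  refine (abs_score_le ha hk hκ (right_mem_Icc.2 T.coe_nonneg)).trans ?_
  have hR := radius_rpow_pos T ρ (K - k)
  unfold noiseConst
  gcongr
  exact le_add_of_nonneg_right (sq_nonneg _)

/-- The noise is differentiable in the exponent along every continuous path, with a quadratic
remainder. -/
theorem abs_noise_taylor_le (ha : 0 < a) (hk : 0 < k) (hκ : κ ∈ Icc k K) (hκ' : κ' ∈ Icc k K)
    (hw : Continuous w) :
    |noise T a ρ κ w - noise T a ρ κ' w - (κ - κ') * scoreNoise T a ρ κ' w|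
      ≤ noiseBound T a ρ k K w * (κ - κ') ^ 2 := by
  have hc : Continuous fun t : ℝ => w t.toNNReal := hw.comp continuous_real_toNNReal
  have i1 := (isPrimitive_signal T a ρ (hk.trans_le hκ.1)).integrable
  have i2 := (isPrimitive_signal T a ρ (hk.trans_le hκ'.1)).integrable
  have i3 := (isPrimitive_score T a ρ (hk.trans_le hκ'.1)).integrable
  have j1 := i1.continuousOn_mul hc.continuousOn
  have j2 := i2.continuousOn_mul hc.continuousOn
  have j3 := i3.continuousOn_mul hc.continuousOn
  have e : noise T a ρ κ w - noise T a ρ κ' w - (κ - κ') * scoreNoise T a ρ κ' w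
      = pathIntegral T
        (fun t => signal a ρ κ t - signal a ρ κ' t - (κ - κ') * score a ρ κ' t)
        (fun t => signalTimeDeriv a ρ κ t - signalTimeDeriv a ρ κ' t
          - (κ - κ') * scoreTimeDeriv a ρ κ' t) w := by
    unfold noise scoreNoise pathIntegral
    have : ∫ t in (0 : ℝ)..T, w t.toNNReal * (signalTimeDeriv a ρ κ t - signalTimeDeriv a ρ κ' t
          - (κ - κ') * scoreTimeDeriv a ρ κ' t)
        = (∫ t in (0 : ℝ)..T, w t.toNNReal * signalTimeDeriv a ρ κ t)
          - (∫ t in (0 : ℝ)..T, w t.toNNReal * signalTimeDeriv a ρ κ' t)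
          - (κ - κ') * ∫ t in (0 : ℝ)..T, w t.toNNReal * scoreTimeDeriv a ρ κ' t := by
      rw [← intervalIntegral.integral_const_mul, ← intervalIntegral.integral_sub j1 j2,
        ← intervalIntegral.integral_sub (j1.sub j2) (j3.const_mul _)]
      refine intervalIntegral.integral_congr fun t _ => ?_
      ring
    rw [this]
    ring
  have e2 : noiseBound T a ρ k K w * (κ - κ') ^ 2 = pathNorm T
      (noiseConst T a ρ k K * (κ - κ') ^ 2) (fun t => noiseWeight T a ρ k K t * (κ - κ') ^ 2) w := by
    unfold noiseBound pathNorm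
    simp_rw [← mul_assoc]
    rw [intervalIntegral.integral_mul_const]
    ring
  rw [e, e2]
  refine abs_pathIntegral_le hw ((i1.sub i2).sub (i3.const_mul _))
    ((intervalIntegrable_noiseWeight T a ρ K hk).mul_const _) ?_
    fun t ht => abs_signalTimeDeriv_taylor_le ha hk hκ hκ' ht
  refine (abs_signal_taylor_le ha hk hκ hκ' (right_mem_Icc.2 T.coe_nonneg)).trans ?_
  refine mul_le_mul_of_nonneg_right ?_ (sq_nonneg _)
  have hR := radius_rpow_pos T ρ (K - k)
  unfold noiseConst
  gcongr
  exact le_add_of_nonneg_left (abs_nonneg _)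

theorem continuousOn_noise (T : ℝ≥0) (ρ : ℝ) (ha : 0 < a) (hk : 0 < k) (hw : Continuous w) :
    ContinuousOn (fun κ => noise T a ρ κ w) (Icc k K) := by
  intro κ' hκ'
  rw [ContinuousWithinAt, tendsto_iff_dist_tendsto_zero]
  set Q := noiseBound T a ρ k K w
  have hlim : Tendsto (fun κ => Q * (κ - κ') ^ 2 + |κ - κ'| * |scoreNoise T a ρ κ' w|)
      (𝓝[Icc k K] κ') (𝓝 0) := by
    have : Continuous fun κ => Q * (κ - κ') ^ 2 + |κ - κ'| * |scoreNoise T a ρ κ' w| := by fun_prop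
    simpa using (this.tendsto κ').mono_left nhdsWithin_le_nhds
  refine tendsto_of_tendsto_of_tendsto_of_le_of_le' tendsto_const_nhds hlim
    (Eventually.of_forall fun _ => dist_nonneg) ?_
  filter_upwards [self_mem_nhdsWithin] with κ hκ
  have h := abs_noise_taylor_le (T := T) (ρ := ρ) ha hk hκ hκ' hw
  rw [Real.dist_eq, ← abs_mul]
  have := abs_add_le (noise T a ρ κ w - noise T a ρ κ' w - (κ - κ') * scoreNoise T a ρ κ' w)
    ((κ - κ') * scoreNoise T a ρ κ' w)
  rw [sub_add_cancel] at this
  linarith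

end Noise

/-! ### The distance of two signals -/

section Distance

variable {T : ℝ≥0} {a ρ k K κ κ' : ℝ}

/-- The squared `L²` distance of two signals. -/
noncomputable def signalSqDist (T : ℝ≥0) (a ρ κ κ' : ℝ) : ℝ :=
  ∫ t in (0 : ℝ)..T, (signal a ρ κ t - signal a ρ κ' t) ^ 2

theorem fisherInfo_eq (T : ℝ≥0) (a ρ κ : ℝ) :
    fisherInfo T a ρ κ = ∫ t in (0 : ℝ)..T, score a ρ κ t ^ 2 := by
  unfold fisherInfo score
  rw [← intervalIntegral.integral_const_mul]
  refine intervalIntegral.integral_congr fun t _ => ?_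
  have : |t - ρ| ^ (2 * κ) = (|t - ρ| ^ κ) ^ 2 := by
    rw [← Real.rpow_mul_natCast (abs_nonneg _), mul_comm]
    norm_num
  simp only [this]
  ring

theorem integral_sq_score_pos (ha : 0 < a) (hρ : ρ ∈ Ioo (0 : ℝ) (T : ℝ)) (hκ : 0 < κ) :
    0 < ∫ t in (0 : ℝ)..T, score a ρ κ t ^ 2 := by
  refine intervalIntegral.integral_pos (hρ.1.trans hρ.2)
    ((continuous_score a ρ hκ).pow 2).continuousOn (fun t _ => sq_nonneg _) ?_
  have hm : 0 < min ρ 1 := lt_min hρ.1 one_pos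
  have h1 := min_le_left ρ 1
  have h2 := min_le_right ρ 1
  -- the score vanishes only at distances `0` and `1` from `ρ`
  refine ⟨ρ - min ρ 1 / 2, ⟨by linarith [hρ.1], by linarith [hρ.2]⟩, ?_⟩
  have e : |ρ - min ρ 1 / 2 - ρ| = min ρ 1 / 2 := by
    rw [sub_sub_cancel_left, abs_neg, abs_of_pos (half_pos hm)]
  have h3 : Real.log (min ρ 1 / 2) ≠ 0 := (Real.log_neg (half_pos hm) (by linarith)).ne
  have h4 := Real.rpow_pos_of_pos (half_pos hm) κ
  unfold score
  rw [e]
  positivity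

/-- The signals are separated: their distance is at least linear in the exponents. -/
theorem exists_le_signalSqDist (ha : 0 < a) (hρ : ρ ∈ Ioo (0 : ℝ) (T : ℝ)) (hk : 0 < k)
    (hkK : k ≤ K) : ∃ c > 0, ∀ κ ∈ Icc k K, ∀ κ' ∈ Icc k K,
      c * (κ - κ') ^ 2 ≤ signalSqDist T a ρ κ κ' := by
  have hK : 0 < K := hk.trans_le hkK
  set A := radius T ρ ^ (K - k)
  have hA : 0 < A := radius_rpow_pos T ρ _
  refine ⟨(∫ t in (0 : ℝ)..T, score a ρ K t ^ 2) / A ^ 2,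
    div_pos (integral_sq_score_pos ha hρ hK) (by positivity), fun κ hκ κ' hκ' => ?_⟩
  rw [div_mul_eq_mul_div, div_le_iff₀ (by positivity)]
  unfold signalSqDist
  rw [← intervalIntegral.integral_mul_const, ← intervalIntegral.integral_mul_const]
  have c1 := continuous_score a ρ hK
  have c2 := continuous_signal a ρ (hk.trans_le hκ.1)
  have c3 := continuous_signal a ρ (hk.trans_le hκ'.1)
  refine intervalIntegral.integral_mono_on T.coe_nonneg
    (Continuous.intervalIntegrable (by fun_prop) _ _)
    (Continuous.intervalIntegrable (by fun_prop) _ _) fun t ht => ?_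
  have h := le_abs_rpow_sub (abs_nonneg (t - ρ)) (abs_sub_le_radius (T := T) ht)
    (one_le_radius T ρ) hk hκ hκ'
  have e1 : score a ρ K t ^ 2 * (κ - κ') ^ 2
      = a ^ 2 * (|κ - κ'| * |(|t - ρ| ^ K * Real.log |t - ρ|)|) ^ 2 := by
    unfold score
    rw [mul_pow |κ - κ'|, sq_abs, sq_abs]
    ring
  have e2 : (signal a ρ κ t - signal a ρ κ' t) ^ 2 * A ^ 2
      = a ^ 2 * (A * |(|t - ρ| ^ κ - |t - ρ| ^ κ')|) ^ 2 := by
    unfold signal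
    rw [mul_pow A, sq_abs]
    ring
  rw [e1, e2]
  gcongr

/-- The squared distance of the signals is to second order given by the Fisher information. -/
theorem exists_abs_signalSqDist_sub_le (T : ℝ≥0) (ρ : ℝ) (ha : 0 < a) (hk : 0 < k)
    (hκ' : κ' ∈ Icc k K) : ∃ C ≥ 0, ∀ κ ∈ Icc k K,
      |signalSqDist T a ρ κ κ' - fisherInfo T a ρ κ' * (κ - κ') ^ 2| ≤ C * |κ - κ'| ^ 3 := by
  set R : ℝ → ℝ := fun t => a * (radius T ρ ^ (K - k) * (|t - ρ| ^ k * Real.log |t - ρ| ^ 2))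
    with hR
  have cR : Continuous R :=
    ((continuous_abs_sub_rpow_mul_log_sq ρ hk).const_mul _).const_mul _
  have hR0 : ∀ t, 0 ≤ R t := fun t => by
    have := radius_rpow_pos T ρ (K - k)
    positivity
  have c1 := continuous_score a ρ (hk.trans_le hκ'.1)
  have c3 := continuous_signal a ρ (hk.trans_le hκ'.1)
  have hG : ∀ t, 0 ≤ 2 * |score a ρ κ' t| * R t + (K - k) * R t ^ 2 := fun t =>
    add_nonneg (mul_nonneg (by positivity) (hR0 t))
      (mul_nonneg (by linarith [hκ'.1, hκ'.2]) (sq_nonneg _))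
  refine ⟨∫ t in (0 : ℝ)..T, (2 * |score a ρ κ' t| * R t + (K - k) * R t ^ 2),
    intervalIntegral.integral_nonneg T.coe_nonneg fun t _ => hG t, fun κ hκ => ?_⟩
  have c2 := continuous_signal a ρ (hk.trans_le hκ.1)
  rw [fisherInfo_eq]
  unfold signalSqDist
  rw [← intervalIntegral.integral_mul_const, ← intervalIntegral.integral_mul_const,
    ← intervalIntegral.integral_sub (Continuous.intervalIntegrable (by fun_prop) _ _)
      (Continuous.intervalIntegrable (by fun_prop) _ _)]
  refine (intervalIntegral.abs_integral_le_integral_abs T.coe_nonneg).trans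
    (intervalIntegral.integral_mono_on T.coe_nonneg
      (Continuous.intervalIntegrable (by fun_prop) _ _)
      (Continuous.intervalIntegrable (by fun_prop) _ _) fun t ht => ?_)
  have h := abs_signal_taylor_le (ρ := ρ) ha hk hκ hκ' ht
  change _ ≤ R t * (κ - κ') ^ 2 at h
  -- with `S_κ - S_κ' = d s + r`, the error in the integrand is `2 d s r + r²`
  set d := κ - κ'
  set s := score a ρ κ' t
  set r := signal a ρ κ t - signal a ρ κ' t - d * s with hr
  have e : (signal a ρ κ t - signal a ρ κ' t) ^ 2 - s ^ 2 * d ^ 2 = 2 * (d * s * r) + r ^ 2 := by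
    rw [hr]
    ring
  have hd : |d| ≤ K - k := abs_le.2 ⟨by linarith [hκ.1, hκ'.2], by linarith [hκ.2, hκ'.1]⟩
  rw [e]
  rw [← sq_abs d] at h
  have h1 : |2 * (d * s * r)| ≤ 2 * |s| * R t * |d| ^ 3 := by
    rw [abs_mul, abs_mul, abs_mul, abs_two]
    calc 2 * (|d| * |s| * |r|) ≤ 2 * (|d| * |s| * (R t * |d| ^ 2)) := by gcongr
      _ = 2 * |s| * R t * |d| ^ 3 := by ring
  have h2 : |r ^ 2| ≤ (K - k) * R t ^ 2 * |d| ^ 3 := by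
    rw [abs_pow]
    calc |r| ^ 2 ≤ (R t * |d| ^ 2) ^ 2 := by gcongr
      _ = |d| * (R t ^ 2 * |d| ^ 3) := by ring
      _ ≤ (K - k) * (R t ^ 2 * |d| ^ 3) := by gcongr
      _ = (K - k) * R t ^ 2 * |d| ^ 3 := by ring
  refine (abs_add_le _ _).trans ?_
  linarith

theorem continuousOn_signalSqDist (T : ℝ≥0) (a ρ : ℝ) (hk : 0 < k) (hκ' : 0 < κ') :
    ContinuousOn (fun κ => signalSqDist T a ρ κ κ') (Icc k K) := by
  rw [continuousOn_iff_continuous_domRestrict]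
  have c : Continuous fun p : Icc k K × ℝ => (signal a ρ p.1 p.2 - signal a ρ κ' p.2) ^ 2 := by
    have c1 : Continuous fun p : Icc k K × ℝ => |p.2 - ρ| ^ (p.1 : ℝ) :=
      Continuous.rpow (by fun_prop) (by fun_prop) fun p => Or.inr (hk.trans_le p.1.2.1)
    have c2 := (continuous_signal a ρ hκ').comp (continuous_snd (X := Icc k K))
    unfold signal at c2 ⊢
    exact ((c1.const_mul a).sub c2).pow 2
  exact intervalIntegral.continuous_parametric_intervalIntegral_of_continuous' c 0 T

end Distance

/-! ### Maximizers of a perturbed quadratic contrast -/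

section Argmax

variable {k K κ₀ I c C b Δ ε : ℝ} {m D z : ℝ → ℝ}

/-- The contrast exceeds its value at the true exponent only at distance `O(ε)`. -/
theorem abs_sub_le_of_contrast_nonneg (hκ₀ : κ₀ ∈ Icc k K) (hc : 0 < c) (hε : 0 < ε)
    (hm : ∀ κ ∈ Icc k K, m κ = -D κ / 2 + ε * z κ)
    (hDc : ∀ κ ∈ Icc k K, c * (κ - κ₀) ^ 2 ≤ D κ) (hΔ : |Δ| ≤ b)
    (hz : ∀ κ ∈ Icc k K, |z κ - (κ - κ₀) * Δ| ≤ b * (κ - κ₀) ^ 2) {κ : ℝ} (hκ : κ ∈ Icc k K)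
    (h0 : 0 ≤ m κ) : |κ - κ₀| ≤ ε * (2 * (1 + (K - k)) * b / c) := by
  rcases (abs_nonneg (κ - κ₀)).eq_or_lt with h | hpos
  · have hb : 0 ≤ b := (abs_nonneg _).trans hΔ
    have hkK : 0 ≤ K - k := by linarith [hκ.1, hκ.2]
    rw [← h]
    positivity
  have hd : |κ - κ₀| ≤ K - k := abs_le.2 ⟨by linarith [hκ.1, hκ₀.2], by linarith [hκ.2, hκ₀.1]⟩
  have hb : 0 ≤ b := (abs_nonneg _).trans hΔ
  have hz1 : z κ ≤ b * |κ - κ₀| + b * |κ - κ₀| ^ 2 := by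
    have h1 := (le_abs_self _).trans (hz κ hκ)
    have h2 : (κ - κ₀) * Δ ≤ b * |κ - κ₀| := by
      rw [mul_comm b]
      exact (le_abs_self _).trans (by rw [abs_mul]; gcongr)
    rw [sq_abs]
    linarith
  have hD := hDc κ hκ
  rw [hm κ hκ] at h0
  have h3 : z κ ≤ b * |κ - κ₀| * (1 + (K - k)) := by
    nlinarith [mul_nonneg (mul_nonneg hb hpos.le) (sub_nonneg.2 hd)]
  rw [← sq_abs] at hD
  have h4 : c * |κ - κ₀| ^ 2 ≤ 2 * (ε * (b * |κ - κ₀| * (1 + (K - k)))) := by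
    have := mul_le_mul_of_nonneg_left h3 hε.le
    linarith
  have h5 : c * |κ - κ₀| ≤ 2 * (ε * (b * (1 + (K - k)))) := by
    refine le_of_mul_le_mul_right ?_ hpos
    linarith
  rw [← mul_div_assoc, le_div_iff₀ hc]
  linarith

/-- If the noise is small, the contrast is maximal in the interior of the parameter interval. -/
theorem exists_interior_max (hκ₀ : κ₀ ∈ Ioo k K) (hc : 0 < c) (hε : 0 < ε)
    (hcont : ContinuousOn m (Icc k K)) (hm0 : m κ₀ = 0)
    (hm : ∀ κ ∈ Icc k K, m κ = -D κ / 2 + ε * z κ)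
    (hDc : ∀ κ ∈ Icc k K, c * (κ - κ₀) ^ 2 ≤ D κ) (hΔ : |Δ| ≤ b)
    (hz : ∀ κ ∈ Icc k K, |z κ - (κ - κ₀) * Δ| ≤ b * (κ - κ₀) ^ 2)
    (hsmall : ε * (2 * (1 + (K - k)) * b / c) < min (κ₀ - k) (K - κ₀)) :
    ∃ κ ∈ Ioo k K, ∀ κ' ∈ Ioo k K, m κ' ≤ m κ := by
  have hκ₀' := Ioo_subset_Icc_self hκ₀
  obtain ⟨κ, hκ, hmax⟩ := isCompact_Icc.exists_isMaxOn ⟨κ₀, hκ₀'⟩ hcont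
  have h := (abs_sub_le_of_contrast_nonneg hκ₀' hc hε hm hDc hΔ hz hκ
    (hm0 ▸ hmax hκ₀')).trans_lt hsmall
  rw [lt_min_iff, abs_lt, abs_lt] at h
  exact ⟨κ, ⟨by linarith [h.1.1], by linarith [h.2.2]⟩,
    fun κ' hκ' => hmax (Ioo_subset_Icc_self hκ')⟩

/-- A maximizer of a perturbed quadratic contrast is close to the maximizer of its quadratic
approximation `u ↦ u Δ - I u² / 2`, at the scale `κ = κ₀ + ε u`. -/
theorem sq_sub_le_of_max (hκ₀ : κ₀ ∈ Ioo k K) (hI : 0 < I) (hc : 0 < c) (hC : 0 ≤ C) (hε : 0 < ε)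
    (hm0 : m κ₀ = 0) (hm : ∀ κ ∈ Icc k K, m κ = -D κ / 2 + ε * z κ)
    (hDc : ∀ κ ∈ Icc k K, c * (κ - κ₀) ^ 2 ≤ D κ)
    (hDI : ∀ κ ∈ Icc k K, |D κ - I * (κ - κ₀) ^ 2| ≤ C * |κ - κ₀| ^ 3) (hΔ : |Δ| ≤ b)
    (hz : ∀ κ ∈ Icc k K, |z κ - (κ - κ₀) * Δ| ≤ b * (κ - κ₀) ^ 2)
    (hsmall : ε * (b / I) < min (κ₀ - k) (K - κ₀)) {κ : ℝ} (hκ : κ ∈ Icc k K)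
    (hmax : ∀ κ' ∈ Ioo k K, m κ' ≤ m κ) :
    I / 2 * ((κ - κ₀) / ε - Δ / I) ^ 2
      ≤ ε * (C / 2 * (2 * (1 + (K - k)) * b / c) ^ 3 + b * (2 * (1 + (K - k)) * b / c) ^ 2
        + C / 2 * (b / I) ^ 3 + b * (b / I) ^ 2) := by
  have hb : 0 ≤ b := (abs_nonneg _).trans hΔ
  set B := 2 * (1 + (K - k)) * b / c
  set v := Δ / I with hv
  set u := (κ - κ₀) / ε with hu
  have hκu : κ - κ₀ = ε * u := by rw [hu]; field_simp
  have huB : |u| ≤ B := by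
    have := abs_sub_le_of_contrast_nonneg (Ioo_subset_Icc_self hκ₀) hc hε hm hDc hΔ hz hκ
      (hm0 ▸ hmax κ₀ hκ₀)
    rw [hκu, abs_mul, abs_of_pos hε] at this
    exact le_of_mul_le_mul_left this hε
  have hvb : |v| ≤ b / I := by
    rw [hv, abs_div, abs_of_pos hI]
    gcongr
  have hΔv : Δ = I * v := by rw [hv]; field_simp
  -- the rescaled contrast differs from its quadratic approximation by a term of order `ε`
  have approx : ∀ q s, κ₀ + ε * q ∈ Icc k K → |q| ≤ s →
      |m (κ₀ + ε * q) - ε ^ 2 * (I * v * q - I / 2 * q ^ 2)|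
        ≤ ε ^ 2 * (ε * (C / 2 * s ^ 3 + b * s ^ 2)) := by
    intro q s hq hs
    have h1 := hDI _ hq
    have h2 := hz _ hq
    rw [add_sub_cancel_left] at h1 h2
    rw [abs_mul, abs_of_pos hε] at h1
    have e : m (κ₀ + ε * q) - ε ^ 2 * (I * v * q - I / 2 * q ^ 2)
        = -(D (κ₀ + ε * q) - I * (ε * q) ^ 2) / 2
          + ε * (z (κ₀ + ε * q) - ε * q * Δ) := by
      rw [hm _ hq, hΔv]
      ring
    have h3 : |q| ^ 3 ≤ s ^ 3 := by gcongr
    have h4 : |q| ^ 2 ≤ s ^ 2 := by gcongr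
    rw [e]
    refine (abs_add_le _ _).trans ?_
    rw [abs_div, abs_neg, abs_two, abs_mul, abs_of_pos hε]
    calc |D (κ₀ + ε * q) - I * (ε * q) ^ 2| / 2 + ε * |z (κ₀ + ε * q) - ε * q * Δ|
        ≤ C * (ε * |q|) ^ 3 / 2 + ε * (b * (ε * q) ^ 2) := by gcongr
      _ = ε ^ 2 * (ε * (C / 2 * |q| ^ 3 + b * |q| ^ 2)) := by
          rw [sq_abs]
          ring
      _ ≤ ε ^ 2 * (ε * (C / 2 * s ^ 3 + b * s ^ 2)) := by gcongr
  -- the maximizer of the quadratic approximation is an admissible competitor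
  have hvmem : κ₀ + ε * v ∈ Ioo k K := by
    have h1 : |ε * v| < min (κ₀ - k) (K - κ₀) := by
      rw [abs_mul, abs_of_pos hε]
      exact (mul_le_mul_of_nonneg_left hvb hε.le).trans_lt hsmall
    rw [lt_min_iff, abs_lt, abs_lt] at h1
    exact ⟨by linarith [h1.1.1], by linarith [h1.2.2]⟩
  have hκ' : κ = κ₀ + ε * u := by linarith
  have a1 := abs_le.1 (approx u B (hκ' ▸ hκ) huB)
  have a2 := abs_le.1 (approx v (b / I) (Ioo_subset_Icc_self hvmem) hvb)
  have a3 := hmax _ hvmem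
  rw [hκ'] at a3
  refine le_of_mul_le_mul_left (a := ε ^ 2) ?_ (by positivity)
  linarith [a1.2, a2.1]

end Argmax

/-! ### Convergence in law on varying spaces -/

section Slutsky

/-- Slutsky's theorem for variables on varying probability spaces: if the laws of the `X i` do not
depend on `i` and `Y i - X i` tends to `0` in probability, then the `Y i` converge in law. -/
theorem tendstoInDistribution_of_hasLaw_of_sub {ι : Type*} {l : Filter ι}
    [l.IsCountablyGenerated] {Ω : ι → Type*}
    [∀ i, MeasurableSpace (Ω i)] {P : ∀ i, Measure (Ω i)} [∀ i, IsProbabilityMeasure (P i)]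
    {μ : Measure ℝ} [IsProbabilityMeasure μ] {X Y : ∀ i, Ω i → ℝ}
    (hX : ∀ᶠ i in l, HasLaw (X i) μ (P i)) (hY : ∀ i, AEMeasurable (Y i) (P i))
    (h : ∀ η > 0, Tendsto (fun i => P i {ω | η ≤ |Y i ω - X i ω|}) l (𝓝 0)) :
    TendstoInDistribution Y l (id : ℝ → ℝ) P μ := by
  refine ⟨hY, aemeasurable_id, ?_⟩
  refine tendsto_iff_forall_lipschitz_integral_tendsto.2 ?_
  rintro F ⟨M, hM⟩ ⟨L, hL⟩
  simp only [ProbabilityMeasure.coe_mk, Measure.map_id]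
  have hFc := hL.continuous
  have hM0 : 0 ≤ M := dist_nonneg.trans (hM 0 0)
  have hFb : ∀ x, ‖F x‖ ≤ ‖F 0‖ + M := fun x => by
    have := norm_sub_norm_le (F x) (F 0)
    rw [← dist_eq_norm] at this
    linarith [hM x 0]
  rw [Metric.tendsto_nhds]
  intro e he
  obtain ⟨η, hη, hηe⟩ : ∃ η > 0, L * η < e / 2 := by
    refine ⟨e / (2 * (L + 1)), by positivity, ?_⟩
    rw [mul_div_assoc', div_lt_div_iff₀ (by positivity) two_pos]
    nlinarith
  have h1 : Tendsto (fun i => M * (P i).real {ω | η ≤ |Y i ω - X i ω|}) l (𝓝 (M * 0)) :=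
    ((ENNReal.tendsto_toReal ENNReal.zero_ne_top).comp (h η hη)).const_mul M
  rw [mul_zero] at h1
  filter_upwards [hX, h1.eventually_lt_const (half_pos he)] with i hXi hi
  have e1 : ∫ x, F x ∂μ = ∫ ω, F (X i ω) ∂P i := by
    rw [← hXi.map_eq, integral_map hXi.aemeasurable hFc.aestronglyMeasurable]
  have hXm := hXi.aemeasurable
  have hYm := hY i
  rw [integral_map hYm hFc.aestronglyMeasurable, e1, Real.dist_eq]
  have iX : Integrable (fun ω => F (X i ω)) (P i) :=
    Integrable.of_bound (by fun_prop) _ (ae_of_all _ fun ω => hFb _)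
  have iY : Integrable (fun ω => F (Y i ω)) (P i) :=
    Integrable.of_bound (by fun_prop) _ (ae_of_all _ fun ω => hFb _)
  have hms : NullMeasurableSet {ω | η ≤ |Y i ω - X i ω|} (P i) :=
    nullMeasurableSet_le aemeasurable_const (by fun_prop)
  rw [← integral_sub iY iX]
  calc |∫ ω, F (Y i ω) - F (X i ω) ∂P i|
      ≤ ∫ ω, |F (Y i ω) - F (X i ω)| ∂P i := abs_integral_le_integral_abs
    _ ≤ ∫ ω, (L * η + {ω | η ≤ |Y i ω - X i ω|}.indicator (fun _ => M) ω) ∂P i := by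
        refine integral_mono (iY.sub iX).abs
          ((integrable_const _).add ((integrable_const M).indicator₀ hms)) fun ω => ?_
        by_cases hω : ω ∈ {ω | η ≤ |Y i ω - X i ω|}
        · simp only [indicator_of_mem hω]
          have := hM (Y i ω) (X i ω)
          rw [Real.dist_eq] at this
          have : 0 ≤ L * η := by positivity
          linarith
        · simp only [indicator_of_notMem hω, add_zero]
          have h2 := hL.dist_le_mul (Y i ω) (X i ω)
          rw [Real.dist_eq, Real.dist_eq] at h2
          exact h2.trans (mul_le_mul_of_nonneg_left (not_le.1 hω).le L.coe_nonneg)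
    _ = L * η + M * (P i).real {ω | η ≤ |Y i ω - X i ω|} := by
        rw [integral_add (integrable_const _) ((integrable_const M).indicator₀ hms),
          integral_indicator₀ hms]
        simp [mul_comm]
    _ < e := by linarith

end Slutsky

/-! ### The likelihood ratio -/

section Likelihood

variable {T : ℝ≥0} {a ρ k K κ κ₀ ε : ℝ}

theorem IsPrimitive.div_const {f g : ℝ → ℝ} (h : IsPrimitive T f g) (c : ℝ) :
    IsPrimitive T (fun t => f t / c) (fun t => g t / c) where
  continuous := h.continuous.div_const c
  integrable := h.integrable.div_const c
  integral_eq s hs t ht := by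
    rw [intervalIntegral.integral_div, h.integral_eq s hs t ht, sub_div]

theorem pathIntegral_div_const (T : ℝ≥0) (f g : ℝ → ℝ) (w : ℝ≥0 → ℝ) (c : ℝ) :
    pathIntegral T (fun t => f t / c) (fun t => g t / c) w = pathIntegral T f g w / c := by
  unfold pathIntegral
  simp_rw [← mul_div_assoc]
  rw [intervalIntegral.integral_div]
  ring

theorem signalSqDist_eq (T : ℝ≥0) (a ρ : ℝ) (hκ : 0 < κ) (hκ₀ : 0 < κ₀) :
    signalSqDist T a ρ κ κ₀ = (∫ t in (0 : ℝ)..T, signal a ρ κ t ^ 2)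
      - 2 * (∫ t in (0 : ℝ)..T, signal a ρ κ t * signal a ρ κ₀ t)
      + ∫ t in (0 : ℝ)..T, signal a ρ κ₀ t ^ 2 := by
  have c1 := continuous_signal a ρ hκ
  have c2 := continuous_signal a ρ hκ₀
  unfold signalSqDist
  rw [← intervalIntegral.integral_const_mul, ← intervalIntegral.integral_sub
    (Continuous.intervalIntegrable (by fun_prop) _ _)
    (Continuous.intervalIntegrable (by fun_prop) _ _), ← intervalIntegral.integral_add
    (Continuous.intervalIntegrable (by fun_prop) _ _)
    (Continuous.intervalIntegrable (by fun_prop) _ _)]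
  refine intervalIntegral.integral_congr fun t _ => ?_
  ring

theorem signalSqDist_self (T : ℝ≥0) (a ρ κ : ℝ) : signalSqDist T a ρ κ κ = 0 := by
  simp [signalSqDist]

/-- The logarithm of the likelihood ratio `V(κ) / V(κ₀)`, multiplied by `ε²`. -/
noncomputable def contrast (T : ℝ≥0) (a ρ κ₀ ε : ℝ) (w : ℝ≥0 → ℝ) (κ : ℝ) : ℝ :=
  -signalSqDist T a ρ κ κ₀ / 2 + ε * (noise T a ρ κ w - noise T a ρ κ₀ w)

theorem contrast_self (T : ℝ≥0) (a ρ κ₀ ε : ℝ) (w : ℝ≥0 → ℝ) :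
    contrast T a ρ κ₀ ε w κ₀ = 0 := by
  simp [contrast, signalSqDist_self]

theorem continuousOn_contrast (T : ℝ≥0) (ρ ε : ℝ) (ha : 0 < a) (hk : 0 < k) (hκ₀ : 0 < κ₀)
    {w : ℝ≥0 → ℝ} (hw : Continuous w) : ContinuousOn (contrast T a ρ κ₀ ε w) (Icc k K) :=
  ((continuousOn_signalSqDist T a ρ hk hκ₀).neg.div_const 2).add
    (((continuousOn_noise T ρ ha hk hw).sub continuousOn_const).const_smul ε)

variable {Ω : Type*} [MeasurableSpace Ω] {P : Measure Ω} [IsProbabilityMeasure P]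
  {W X : ℝ≥0 → Ω → ℝ} {V : ℝ → Ω → ℝ}

/-- Almost surely, the likelihood ratio is for all exponents the exponential of the contrast, up to
a factor which does not depend on the exponent. For a single exponent this identifies the stochastic
integral; both sides are continuous in the exponent. -/
theorem ae_likelihood_eq (ha : 0 < a) (hk : 0 < k) (hκ₀ : κ₀ ∈ Icc k K) (hε : 0 < ε)
    (hW : IsBrownianReal W P) (hX : IsObservation P T a ρ κ₀ ε W X)
    (hV : IsLikelihoodRatio P T a ρ k K ε X V) :
    ∀ᵐ ω ∂P, ∃ c, ∀ κ ∈ Icc k K,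
      V κ ω = Real.exp ((c + contrast T a ρ κ₀ ε (fun t => W t ω) κ) / ε ^ 2) := by
  have hκ₀0 : 0 < κ₀ := hk.trans_le hκ₀.1
  -- the contrast is normalized to vanish at `κ₀`; these are the terms subtracted for that
  set c : Ω → ℝ := fun ω => (∫ t in (0 : ℝ)..T, signal a ρ κ₀ t ^ 2) / 2
    + ε * noise T a ρ κ₀ fun t => W t ω with hc
  have point : ∀ κ ∈ Icc k K, ∀ᵐ ω ∂P,
      V κ ω = Real.exp ((c ω + contrast T a ρ κ₀ ε (fun t => W t ω) κ) / ε ^ 2) := by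
    intro κ hκ
    have hκ0 : 0 < κ := hk.trans_le hκ.1
    obtain ⟨I, hI, hVI⟩ := hV.eq_exp κ hκ
    have hprim := (isPrimitive_signal T a ρ hκ0).div_const (ε ^ 2)
    have hIe := hI.ae_eq hW (continuous_signal a ρ hκ₀0) hX hprim
    filter_upwards [hVI, hIe] with ω h1 h2
    rw [h1, h2, pathIntegral_div_const]
    congr 1
    have e1 : ∫ t in (0 : ℝ)..T, signal a ρ κ t / ε ^ 2 * signal a ρ κ₀ t
        = (∫ t in (0 : ℝ)..T, signal a ρ κ t * signal a ρ κ₀ t) / ε ^ 2 := by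
      rw [← intervalIntegral.integral_div]
      refine intervalIntegral.integral_congr fun t _ => ?_
      ring
    have e2 : ∫ t in (0 : ℝ)..T, a ^ 2 * |t - ρ| ^ (2 * κ) / (2 * ε ^ 2)
        = (∫ t in (0 : ℝ)..T, signal a ρ κ t ^ 2) / (2 * ε ^ 2) := by
      rw [← intervalIntegral.integral_div]
      refine intervalIntegral.integral_congr fun t _ => ?_
      have : |t - ρ| ^ (2 * κ) = (|t - ρ| ^ κ) ^ 2 := by
        rw [← Real.rpow_mul_natCast (abs_nonneg _), mul_comm]
        norm_num
      simp only [this, signal, mul_pow]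
    rw [e1, e2, hc]
    unfold contrast
    rw [signalSqDist_eq T a ρ hκ0 hκ₀0]
    unfold noise
    field_simp
    ring
  have : Nonempty (Icc k K) := ⟨⟨κ₀, hκ₀⟩⟩
  have hall : ∀ᵐ ω ∂P, ∀ n, V (TopologicalSpace.denseSeq (Icc k K) n) ω
      = Real.exp ((c ω + contrast T a ρ κ₀ ε (fun t => W t ω)
        (TopologicalSpace.denseSeq (Icc k K) n)) / ε ^ 2) :=
    ae_all_iff.2 fun n => point _ (TopologicalSpace.denseSeq (Icc k K) n).2
  filter_upwards [hall, hV.continuousOn, hW.cont] with ω h1 h2 h3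
  refine ⟨c ω, fun κ hκ => ?_⟩
  have h4 : ContinuousOn (fun κ => Real.exp ((c ω + contrast T a ρ κ₀ ε (fun t => W t ω) κ)
      / ε ^ 2)) (Icc k K) :=
    Real.continuous_exp.comp_continuousOn
      ((continuousOn_const.add (continuousOn_contrast T ρ ε ha hk hκ₀0 h3)).div_const _)
  have h5 := Continuous.ext_on (TopologicalSpace.denseRange_denseSeq (Icc k K))
    (continuousOn_iff_continuous_domRestrict.1 h2) (continuousOn_iff_continuous_domRestrict.1 h4)
    (by rintro _ ⟨n, rfl⟩; exact h1 n)
  exact congrFun h5 ⟨κ, hκ⟩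

/-- As `ε → 0`, the rescaled error of a maximum likelihood estimator is close to the score
divided by the Fisher information, outside an event on which the noise is large. -/
theorem eventually_measure_error_le (ha : 0 < a) (hρ : ρ ∈ Ioo (0 : ℝ) (T : ℝ)) (hk : 0 < k)
    (hκ₀ : κ₀ ∈ Ioo k K) (b : ℝ) {η : ℝ} (hη : 0 < η) :
    ∀ᶠ ε in 𝓝[>] (0 : ℝ), ∀ {Ω : Type*} [MeasurableSpace Ω] (P : Measure Ω)
      [IsProbabilityMeasure P] (W X : ℝ≥0 → Ω → ℝ) (V : ℝ → Ω → ℝ) (κhat : Ω → ℝ),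
      IsBrownianReal W P → IsObservation P T a ρ κ₀ ε W X →
      IsLikelihoodRatio P T a ρ k K ε X V → IsMLE P k K V κhat →
      P {ω | η ≤ |(κhat ω - κ₀) / ε
          - scoreNoise T a ρ κ₀ (fun t => W t ω) / fisherInfo T a ρ κ₀|}
        ≤ P {ω | b ≤ noiseBound T a ρ k K fun t => W t ω} := by
  have hκ₀' := Ioo_subset_Icc_self hκ₀
  have hκ₀0 : 0 < κ₀ := hk.trans hκ₀.1
  set I := fisherInfo T a ρ κ₀
  have hI : 0 < I := by
    rw [show I = _ from fisherInfo_eq T a ρ κ₀]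
    exact integral_sq_score_pos ha hρ hκ₀0
  obtain ⟨c, hc, hDc⟩ := exists_le_signalSqDist ha hρ hk (hκ₀.1.trans hκ₀.2).le
  obtain ⟨C, hC, hDI⟩ := exists_abs_signalSqDist_sub_le T ρ ha hk hκ₀'
  have hr : 0 < min (κ₀ - k) (K - κ₀) := lt_min (sub_pos.2 hκ₀.1) (sub_pos.2 hκ₀.2)
  have small : ∀ A s : ℝ, 0 < s → ∀ᶠ ε in 𝓝[>] (0 : ℝ), ε * A < s := fun A s hs => by
    have : Tendsto (fun ε : ℝ => ε * A) (𝓝[>] 0) (𝓝 (0 * A)) :=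
      ((continuous_id.mul continuous_const).tendsto 0).mono_left nhdsWithin_le_nhds
    rw [zero_mul] at this
    exact this.eventually_lt_const hs
  -- conditions on `ε`: the maximizers of the contrast are interior, the maximizer of its quadratic
  -- approximation is interior, and the two are close
  filter_upwards [self_mem_nhdsWithin, small (2 * (1 + (K - k)) * b / c) _ hr, small (b / I) _ hr,
    small (C / 2 * (2 * (1 + (K - k)) * b / c) ^ 3 + b * (2 * (1 + (K - k)) * b / c) ^ 2
        + C / 2 * (b / I) ^ 3 + b * (b / I) ^ 2) (I / 2 * η ^ 2) (by positivity)] with ε hε s1 s2 s3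
  intro Ω _ P _ W X V κhat hW hX hV hκhat
  have hε : 0 < ε := hε
  refine measure_mono_ae ?_
  filter_upwards [ae_likelihood_eq ha hk hκ₀' hε hW hX hV, hW.cont, hκhat]
    with ω ⟨c₀, hVm⟩ hw hmle herr
  change b ≤ noiseBound T a ρ k K fun t => W t ω
  change η ≤ |(κhat ω - κ₀) / ε - scoreNoise T a ρ κ₀ (fun t => W t ω) / I| at herr
  by_contra! hb
  set w : ℝ≥0 → ℝ := fun t => W t ω
  set m := contrast T a ρ κ₀ ε w
  have hΔ := (abs_scoreNoise_le (T := T) (ρ := ρ) ha hk hκ₀' hw).trans hb.le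
  have hz : ∀ κ ∈ Icc k K, |(noise T a ρ κ w - noise T a ρ κ₀ w)
      - (κ - κ₀) * scoreNoise T a ρ κ₀ w| ≤ b * (κ - κ₀) ^ 2 := fun κ hκ =>
    (abs_noise_taylor_le ha hk hκ hκ₀' hw).trans
      (mul_le_mul_of_nonneg_right hb.le (sq_nonneg _))
  have hm : ∀ κ ∈ Icc k K, m κ = -signalSqDist T a ρ κ κ₀ / 2
      + ε * (noise T a ρ κ w - noise T a ρ κ₀ w) := fun κ _ => rfl
  have hm0 : m κ₀ = 0 := contrast_self T a ρ κ₀ ε w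
  -- likelihood ratio and contrast have the same maximizers
  have hVle : ∀ κ ∈ Icc k K, ∀ κ' ∈ Icc k K, V κ' ω ≤ V κ ω ↔ m κ' ≤ m κ := by
    intro κ hκ κ' hκ'
    rw [hVm κ hκ, hVm κ' hκ', Real.exp_le_exp, div_le_div_iff_of_pos_right (by positivity),
      add_le_add_iff_left]
  obtain ⟨κ₁, hκ₁, hmax₁⟩ := exists_interior_max hκ₀ hc hε
    (continuousOn_contrast T ρ ε ha hk hκ₀0 hw) hm0 hm (fun κ hκ => hDc κ hκ κ₀ hκ₀') hΔ hz s1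
  obtain ⟨hmem, hlub⟩ := hmle ⟨κ₁, hκ₁, fun κ' hκ' =>
    (hVle _ (Ioo_subset_Icc_self hκ₁) _ (Ioo_subset_Icc_self hκ')).2 (hmax₁ κ' hκ')⟩
  have hmax : ∀ κ' ∈ Ioo k K, m κ' ≤ m (κhat ω) := fun κ' hκ' =>
    (hVle _ hmem _ (Ioo_subset_Icc_self hκ')).1 (hlub.1 ⟨κ', hκ', rfl⟩)
  have key := (sq_sub_le_of_max hκ₀ hI hc hC hε hm0 hm (fun κ hκ => hDc κ hκ κ₀ hκ₀') hDI hΔ hz s2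
    hmem hmax).trans_lt s3
  rw [← sq_abs ((κhat ω - κ₀) / ε - _)] at key
  have : η ^ 2 ≤ |(κhat ω - κ₀) / ε - scoreNoise T a ρ κ₀ w / I| ^ 2 := by gcongr
  nlinarith

theorem hasLaw_scoreNoise_div (hW : IsBrownianReal W P) (a ρ : ℝ) (hκ₀ : 0 < κ₀)
    (hI : 0 < fisherInfo T a ρ κ₀) :
    HasLaw (fun ω => scoreNoise T a ρ κ₀ (fun t => W t ω) / fisherInfo T a ρ κ₀)
      (gaussianReal 0 (Real.toNNReal (fisherInfo T a ρ κ₀)⁻¹)) P := by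
  have h := gaussianReal_div_const (hasLaw_pathIntegral hW (isPrimitive_score T a ρ hκ₀))
    (fisherInfo T a ρ κ₀)
  rw [← fisherInfo_eq, zero_div] at h
  have e : Real.toNNReal (fisherInfo T a ρ κ₀)⁻¹ = (fisherInfo T a ρ κ₀).toNNReal
      / NNReal.mk (fisherInfo T a ρ κ₀ ^ 2) (sq_nonneg _) := by
    ext
    rw [NNReal.coe_div, NNReal.coe_mk, Real.coe_toNNReal _ hI.le,
      Real.coe_toNNReal _ (inv_pos.2 hI).le]
    field_simp
  rw [e]
  exact h

end Likelihood

end CuspExponent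

theorem mainTheorem3
    (T : ℝ≥0) (a ρ k K κ₀ : ℝ)
    (ha : 0 < a) (hρ : ρ ∈ Ioo (0 : ℝ) (T : ℝ)) (hk : 0 < k) (hκ₀ : κ₀ ∈ Ioo k K)
    {Ω : ℝ → Type*} [∀ ε, MeasurableSpace (Ω ε)]
    (P : ∀ ε, Measure (Ω ε)) [∀ ε, IsProbabilityMeasure (P ε)]
    (W X : ∀ ε, ℝ≥0 → Ω ε → ℝ) (V : ∀ ε, ℝ → Ω ε → ℝ) (κhat : ∀ ε, Ω ε → ℝ)
    (hW : ∀ ε, 0 < ε → IsBrownianReal (W ε) (P ε))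
    (hX : ∀ ε, 0 < ε → CuspExponent.IsObservation (P ε) T a ρ κ₀ ε (W ε) (X ε))
    (hV : ∀ ε, 0 < ε → CuspExponent.IsLikelihoodRatio (P ε) T a ρ k K ε (X ε) (V ε))
    (hκhat_meas : ∀ ε, AEMeasurable (κhat ε) (P ε))
    (hκhat : ∀ ε, 0 < ε → CuspExponent.IsMLE (P ε) k K (V ε) (κhat ε)) :
    IntervalIntegrable (fun t : ℝ => |t - ρ| ^ (2 * κ₀) * (Real.log |t - ρ|) ^ 2)
      volume 0 (T : ℝ) ∧
    0 < CuspExponent.fisherInfo T a ρ κ₀ ∧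
    TendstoInDistribution (fun ε ω => (κhat ε ω - κ₀) / ε) (𝓝[>] (0 : ℝ)) (id : ℝ → ℝ) P
      (gaussianReal 0 (Real.toNNReal (CuspExponent.fisherInfo T a ρ κ₀)⁻¹)) := by
  have hκ₀0 : 0 < κ₀ := hk.trans hκ₀.1
  have hK : 0 < K := hκ₀0.trans hκ₀.2
  have hI : 0 < CuspExponent.fisherInfo T a ρ κ₀ := by
    rw [CuspExponent.fisherInfo_eq]
    exact CuspExponent.integral_sq_score_pos ha hρ hκ₀0
  refine ⟨(CuspExponent.continuous_abs_sub_rpow_mul_log_sq ρ (by positivity)).intervalIntegrable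
    _ _, hI, ?_⟩
  refine CuspExponent.tendstoInDistribution_of_hasLaw_of_sub
    (X := fun ε ω => CuspExponent.scoreNoise T a ρ κ₀ (fun t => W ε t ω)
      / CuspExponent.fisherInfo T a ρ κ₀)
    ?_ (fun ε => ((hκhat_meas ε).sub_const κ₀).div_const ε) fun η hη => ?_
  · filter_upwards [self_mem_nhdsWithin] with ε hε
    exact CuspExponent.hasLaw_scoreNoise_div (hW ε hε) a ρ hκ₀0 hI
  rw [ENNReal.tendsto_nhds_zero]
  intro e he
  -- a level `b` that the noise exceeds with probability at most `e`, uniformly in `ε`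
  obtain ⟨b, hb, hbe⟩ : ∃ b > 0, ENNReal.ofReal ((1 + T) * (CuspExponent.noiseConst T a ρ k K
      + ∫ t in (0 : ℝ)..T, CuspExponent.noiseWeight T a ρ k K t) / b) ≤ e := by
    have := ENNReal.tendsto_ofReal (tendsto_const_nhds.div_atTop tendsto_id
      (a := (1 + T) * (CuspExponent.noiseConst T a ρ k K
        + ∫ t in (0 : ℝ)..T, CuspExponent.noiseWeight T a ρ k K t)) (l := atTop) (g := id))
    rw [ENNReal.ofReal_zero] at this
    obtain ⟨b, h1, h2⟩ := ((ENNReal.tendsto_nhds_zero.1 this e he).and (eventually_gt_atTop 0)).exists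
    exact ⟨b, h2, h1⟩
  filter_upwards [self_mem_nhdsWithin,
    CuspExponent.eventually_measure_error_le ha hρ hk hκ₀ b hη] with ε hε h
  exact (h (P ε) (W ε) (X ε) (V ε) (κhat ε) (hW ε hε) (hX ε hε) (hV ε hε) (hκhat ε hε)).trans
    ((CuspExponent.measure_le_pathNorm_le (hW ε hε) (CuspExponent.noiseConst_nonneg ha)
      (CuspExponent.intervalIntegrable_noiseWeight T a ρ K hk)
      (CuspExponent.noiseWeight_nonneg ha hK.le) hb).trans hbe)
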